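/- **Setting.** Let $\phi$ be the coordinatewise ReLU. A fully connected network with $d\ge 2$ layers and widths $h_0,\dots,h_d$ has parameters $\theta=(A_1,\dots,A_d)$, $A_i\in\mathbb R^{h_i\times h_{i-1}}$; on input $x=x^0$ it computes $x^1=A_1x^0$, $x^i=A_i\phi(x^{i-1})$ $(2\le i\le d)$ and $f_\theta(x)=x^d$. For $i\le j$ let $M^{i,j}$ be the map $x^i\mapsto x^j$ and $J^{i,j}_{x^i}$ its Jacobian at $x^i$. Let $h_{\min}=\min_{1\le i\le d-1}h_i$. Fix a finite non-empty sample $S$ of pairs $(x,y)$, and let $L(f)=\frac1{|S|}\sum_{(x,y)\in S}l(y,f(x))$, where $l(y,\cdot)$ is convex and $\beta$-Lipschitz for every $y$. Norms are Euclidean norms of vectors and operator norms of matrices; $\|\cdot\|_F$ is the Frobenius norm and $[A]_j$ the $j$-th column of $A$. *Dropout* with probability $p$ multiplies every column of every matrix $A_2,\dots,A_d$ by independent factors, equal to $0$ with probability $p$ and to $\frac1{1-p}$ with probability $1-p$; this gives $\hat A_2,\dots,\hat A_d$. Put $\theta^i=(A_1,\hat A_2,\dots,\hat A_i,A_{i+1},\dots,A_d)$,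 and let $\hat x^i_q(t)$ be the vector before activation at layer $i$ computed with the parameters $t\theta+(1-t)\theta^q$. *Noise stability quantities* (minima and maxima over the inputs $x$ of $S$): $$\mu_i=\min_x\frac{\|A_i\phi(x^{i-1})\|}{\|A_i\|_F\|\phi(x^{i-1})\|},\quad \mu_{i\to}=\min_{i\le j\le d}\min_x\frac{\|J^{i,j}_{x^i}x^i\|}{\|J^{i,j}_{x^i}\|\|x^i\|},\quad c=\max_{x,\,1\le i\le d-1}\frac{\|x^i\|}{\|\phi(x^i)\|}.$$ Given a width bound $W$ and a constant $K_1$, the network $\theta$ is *$\epsilon$-noise stable* (for dropout probability $p$) if $h_{\min}\ge W$; if $\mu_i\mu_{i\to}>0$ for $2\le i\le d$; if there is $\rho\ge 3d$ such that with probability at least $\frac12$ over the dropout the following two properties hold: - for all $2\le i\le j\le d$, $x$ in $S$, $t\in[0,1]$ and $q\in\{i,i-1\}$, $\|M^{i,j}(\hat x^i_q(t))-J^{i,j}_{x^i}\hat x^i_q(t)\|\le\frac{\|\hat x^i_q(t)-x^i\|\,\|x^j\|}{\rho\|x^i\|}$; - for all $1\le i\le d-1$, $x$ in $S$ and $t\in[0,1]$,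 $\|\phi(\hat x^i_i(t))\|_\infty\le\frac{K_1}{\sqrt{h_i}}\|\phi(\hat x^i_i(t))\|$; and if $$\frac{\beta\,c\,d^{3/2}\max_{x}\|f_\theta(x)\|}{h_{\min}^{1/2}\min_{2\le i\le d}(\mu_i\mu_{i\to})}\le\epsilon .$$ Finally let $\Lambda(\theta)=\log\bigl(2+|S|+d+\beta+\max_{x}\|x\|+\tfrac1\epsilon+\sum_{i=1}^d(h_i+\|A_i\|)\bigr)$ (with $\frac1\epsilon$ read as $0$ if $\epsilon=0$). **Theorem.** For all $K_1,K_2>0$ there are constants $C_0,C>0$ and $k_0,k\in\mathbb N$, depending only on $K_1,K_2$, such that the following holds for all data as above. Put $W=C_0\log^{k_0}(d+1)$. Let $\theta^*$ be a network with $d$ layers, widths $h_i^*$, the same input and output dimensions $h_0^*=h_0$, $h_d^*=h_d$, and $\min_{1\le i\le d-1}h_i^*\ge W$. Let $p$ satisfy $1.5\max_{1\le i\le d-1}(h_i^*/h_i)\le p\le\frac34$. Let $\theta^A,\theta^B$ be two networks with widths $h_0,\dots,h_d$ that are $\epsilon$-noise stable for dropout probability $p$ (with width bound $W$ and constant $K_1$),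 and suppose that the weight matrices $A_i$ of each of them satisfy $\|[A_i]_j\|\le K_2\sqrt p\,\|A_i\|_F$ for $2\le i\le d$, $1\le j\le h_{i-1}$. Then there is a continuous path $\pi:[0,1]\to\mathbb R^{h_1\times h_0}\times\cdots\times\mathbb R^{h_d\times h_{d-1}}$ from $\theta^A$ to $\theta^B$, consisting of 13 line segments, such that for all $t\in[0,1]$ $$L(f_{\pi(t)})\le\max\bigl\{L(f_{\theta^A})+C\Lambda(\theta^A)^k\sqrt p\,\epsilon,\ L(f_{\theta^B})+C\Lambda(\theta^B)^k\sqrt p\,\epsilon,\ L(f_{\theta^*})\bigr\}.$$ -/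

import Mathlib

open MeasureTheory Set

noncomputable section

namespace DeepNet

/-- Euclidean space of dimension `n` (with the `ℓ²` norm). -/
abbrev E (n : ℕ) : Type := EuclideanSpace ℝ (Fin n)

/-- Coordinatewise ReLU activation `φ`. -/
def relu {n : ℕ} (v : E n) : E n := WithLp.toLp 2 fun j => max (v j) 0

/-- The parameter space of fully connected networks with `d` layers and widths
`h 0, h 1, …, h d` (`h 0` is the input dimension and `h d` the output dimension; other values of
`h` play no role). For `k : Fin d`, `θ k` is the weight matrix of layer `k + 1`. -/
abbrev Params (d : ℕ) (h : ℕ → ℕ) : Type :=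
  (k : Fin d) → Matrix (Fin (h (k + 1))) (Fin (h k)) ℝ

/-- Matrix-vector product in Euclidean spaces. -/
def mulE {n m : ℕ} (A : Matrix (Fin m) (Fin n) ℝ) (v : E n) : E m :=
  WithLp.toLp 2 (A.mulVec v.ofLp)

/-- What layer `k + 1` does to the vector `x^k` before its matrix is applied: nothing to the
input `x^0`, and ReLU for `k ≥ 1`. -/
def act {n : ℕ} : ℕ → E n → E n
  | 0, v => v
  | _ + 1, v => relu v

/-- Layer `k + 1` as a map from the pre-activation vector `x^k` to `x^(k+1)`, for `k < d`. -/
def layer {d : ℕ} {h : ℕ → ℕ} (θ : Params d h) (k : ℕ) (v : E (h k)) : E (h (k + 1)) :=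
  if hk : k < d then mulE (θ ⟨k, hk⟩) (act k v) else 0

/-- The vector `x^k` before activation at layer `k` on input `x`, with `x^0 = x`. -/
def pre {d : ℕ} {h : ℕ → ℕ} (θ : Params d h) (x : E (h 0)) : (k : ℕ) → E (h k)
  | 0 => x
  | k + 1 => layer θ k (pre θ x k)

/-- The function `f_θ` computed by the network. -/
def net {d : ℕ} {h : ℕ → ℕ} (θ : Params d h) (x : E (h 0)) : E (h d) := pre θ x d

/-- The operator `M^{i,i+n}` that maps the pre-activation vector of layer `i` to that of layer
`i + n`. -/
def comp {d : ℕ} {h : ℕ → ℕ} (θ : Params d h) (i : ℕ) : (n : ℕ) → E (h i) → E (h (i + n))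
  | 0, v => v
  | n + 1, v => layer θ (i + n) (comp θ i n v)

/-- The Jacobian `J^{i,i+n}_{x^i}` of `M^{i,i+n}` at the vector `x^i` computed from `x`. -/
def jac {d : ℕ} {h : ℕ → ℕ} (θ : Params d h) (x : E (h 0)) (i n : ℕ) :
    E (h i) →L[ℝ] E (h (i + n)) :=
  fderiv ℝ (comp θ i n) (pre θ x i)

/-- The empirical loss of a predictor `f` on the sample `(X s, Y s)`, `s : Fin m`. -/
def empLoss {m a b : ℕ} (l : E b → E b → ℝ) (X : Fin m → E a) (Y : Fin m → E b)
    (f : E a → E b) : ℝ :=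
  (1 / (m : ℝ)) * ∑ s, l (Y s) (f (X s))

/-- Identification of Euclidean spaces of equal dimension. -/
def castE {a b : ℕ} (e : a = b) (v : E a) : E b := WithLp.toLp 2 fun j => v (Fin.cast e.symm j)

/-- Minimum width `h_min` of the hidden layers `1, …, d - 1`. -/
def minWidth (d : ℕ) (h : ℕ → ℕ) : ℕ := ⨅ k : Fin (d - 1), h (k + 1)

/-- Frobenius norm. -/
def frob {n m : ℕ} (A : Matrix (Fin m) (Fin n) ℝ) : ℝ := √(∑ i, ∑ j, A i j ^ 2)

/-- Euclidean norm of the `j`-th column. -/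
def colNorm {n m : ℕ} (A : Matrix (Fin m) (Fin n) ℝ) (j : Fin n) : ℝ := √(∑ i, A i j ^ 2)

/-- Operator (spectral) norm. -/
def opNorm {n m : ℕ} (A : Matrix (Fin m) (Fin n) ℝ) : ℝ :=
  ‖LinearMap.toContinuousLinearMap (Matrix.toLpLin 2 2 A)‖

/-! ### Dropout -/

/-- The sample space of dropout: one bit for every column of every weight matrix, `true` meaning
that the column is dropped. -/
abbrev Mask (d : ℕ) (h : ℕ → ℕ) : Type := ((k : Fin d) × Fin (h k)) → Bool

/-- The law of one bit: `true` with probability `p`, `false` with probability `1 - p`. -/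
def bitLaw (p : ℝ) : Measure Bool :=
  ENNReal.ofReal p • Measure.dirac true + ENNReal.ofReal (1 - p) • Measure.dirac false

instance (p : ℝ) : IsFiniteMeasure (bitLaw p) := by
  refine ⟨?_⟩
  simp [bitLaw]

/-- The law of the dropout mask: independent bits. -/
def maskLaw (d : ℕ) (h : ℕ → ℕ) (p : ℝ) : Measure (Mask d h) := Measure.pi fun _ => bitLaw p

/-- The dropped-out weight matrix of layer `k + 1`: column `j` is multiplied by `0` if it is
dropped and by `1 / (1 - p)` otherwise. -/
def dropLayer {d : ℕ} {h : ℕ → ℕ} (p : ℝ) (θ : Params d h) (ω : Mask d h) (k : Fin d) :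
    Matrix (Fin (h (k + 1))) (Fin (h k)) ℝ :=
  Matrix.of fun r j => (if ω ⟨k, j⟩ then 0 else 1 / (1 - p)) * θ k r j

/-- The network `θ^i`, in which the layers `2, …, i` are dropped out. -/
def dropUpTo {d : ℕ} {h : ℕ → ℕ} (p : ℝ) (θ : Params d h) (ω : Mask d h) (i : ℕ) : Params d h :=
  fun k => if 2 ≤ (k : ℕ) + 1 ∧ (k : ℕ) + 1 ≤ i then dropLayer p θ ω k else θ k

/-- The vector `x̂^i_q(t)` before activation at layer `i`, computed with the parameters
`t θ + (1 - t) θ^q`. -/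
def hatX {d : ℕ} {h : ℕ → ℕ} (p : ℝ) (θ : Params d h) (ω : Mask d h) (x : E (h 0))
    (i q : ℕ) (t : ℝ) : E (h i) :=
  pre (t • θ + (1 - t) • dropUpTo p θ ω q) x i

/-! ### Noise stability -/

/-- The layer cushion of layer `k + 1` (for `k ≥ 1`). -/
def layerCushion {d m : ℕ} {h : ℕ → ℕ} (θ : Params d h) (X : Fin m → E (h 0)) (k : Fin d) : ℝ :=
  ⨅ s, ‖mulE (θ k) (relu (pre θ (X s) k))‖ / (frob (θ k) * ‖relu (pre θ (X s) k)‖)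

/-- The interlayer cushion `μ_{i,i+n}`. -/
def interlayerCushion {d m : ℕ} {h : ℕ → ℕ} (θ : Params d h) (X : Fin m → E (h 0))
    (i n : ℕ) : ℝ :=
  ⨅ s, ‖jac θ (X s) i n (pre θ (X s) i)‖ / (‖jac θ (X s) i n‖ * ‖pre θ (X s) i‖)

/-- The minimal interlayer cushion of layer `i ≤ d`: the minimum of `μ_{i,j}` over
`i ≤ j ≤ d`. -/
def minInterlayerCushion {d m : ℕ} {h : ℕ → ℕ} (θ : Params d h) (X : Fin m → E (h 0))
    (i : ℕ) : ℝ :=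
  ⨅ n : Fin (d - i + 1), interlayerCushion θ X i n

/-- The minimum over the layers `2 ≤ i ≤ d` of (layer cushion) times (minimal interlayer
cushion); here `i = k + 2`. -/
def minCushion {d m : ℕ} {h : ℕ → ℕ} (θ : Params d h) (X : Fin m → E (h 0)) : ℝ :=
  ⨅ k : Fin (d - 1),
    layerCushion θ X ⟨k + 1, by omega⟩ * minInterlayerCushion θ X (k + 2)

/-- The activation contraction `c`, a maximum over the sample and the hidden layers. -/
def actContraction {d m : ℕ} {h : ℕ → ℕ} (θ : Params d h) (X : Fin m → E (h 0)) : ℝ :=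
  ⨆ z : Fin m × Fin (d - 1),
    ‖pre θ (X z.1) (z.2 + 1)‖ / ‖relu (pre θ (X z.1) (z.2 + 1))‖

/-- The interlayer smoothness inequalities with parameter `ρ`, for the outcome `ω` of dropout. -/
def SmoothAt {d m : ℕ} {h : ℕ → ℕ} (p ρ : ℝ) (θ : Params d h) (X : Fin m → E (h 0))
    (ω : Mask d h) : Prop :=
  ∀ i n : ℕ, 2 ≤ i → i + n ≤ d → ∀ s : Fin m, ∀ t ∈ Icc (0 : ℝ) 1, ∀ q : ℕ,
    (q = i ∨ q = i - 1) →
    ‖comp θ i n (hatX p θ ω (X s) i q t) - jac θ (X s) i n (hatX p θ ω (X s) i q t)‖ ≤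
      ‖hatX p θ ω (X s) i q t - pre θ (X s) i‖ * ‖pre θ (X s) (i + n)‖ /
        (ρ * ‖pre θ (X s) i‖)

/-- Flatness of the hidden activations with constant `K`, for the outcome `ω` of dropout:
`‖φ(x̂^i_i(t))‖_∞ ≤ (K / √h_i) ‖φ(x̂^i_i(t))‖`. -/
def FlatAt {d m : ℕ} {h : ℕ → ℕ} (p K : ℝ) (θ : Params d h) (X : Fin m → E (h 0))
    (ω : Mask d h) : Prop :=
  ∀ i : ℕ, 1 ≤ i → i ≤ d - 1 → ∀ s : Fin m, ∀ t ∈ Icc (0 : ℝ) 1, ∀ j : Fin (h i),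
    |relu (hatX p θ ω (X s) i i t) j| ≤
      K / √(h i) * ‖relu (hatX p θ ω (X s) i i t)‖

/-- The number `β c d^{3/2} max ‖f_θ(x)‖ / (h_min^{1/2} min_i (μ_i μ_{i→}))`. -/
def stabilityNumber {d m : ℕ} {h : ℕ → ℕ} (β : ℝ) (θ : Params d h) (X : Fin m → E (h 0)) : ℝ :=
  β * actContraction θ X * (d : ℝ) ^ (3 / 2 : ℝ) * (⨆ s, ‖net θ (X s)‖) /
    (√(minWidth d h) * minCushion θ X)

/-- `ε`-noise stability under dropout with probability `p`. `W` is the lower bound on the width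
and `K` the constant of the flatness condition. Positivity of the cushions says that the
quotients that define them, and `ε`, are meaningful and that `ε` is finite. -/
structure NoiseStable {d m : ℕ} {h : ℕ → ℕ} (W K p β ε : ℝ) (θ : Params d h)
    (X : Fin m → E (h 0)) : Prop where
  width : W ≤ minWidth d h
  cushion_pos : 0 < minCushion θ X
  smooth_flat : ∃ ρ : ℝ, 3 * (d : ℝ) ≤ ρ ∧
    1 / 2 ≤ maskLaw d h p {ω | SmoothAt p ρ θ X ω ∧ FlatAt p K θ X ω}
  number_le : stabilityNumber β θ X ≤ ε

/-- The logarithmic quantity whose powers are suppressed in the error bound: the logarithm of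
the sample size, the depth, the Lipschitz constant, the norms of the inputs, `1 / ε`, the widths
and the norms of the weight matrices. -/
def logFactor {d m : ℕ} {h : ℕ → ℕ} (β ε : ℝ) (θ : Params d h) (X : Fin m → E (h 0)) : ℝ :=
  Real.log (2 + m + d + β + (⨆ s, ‖X s‖) + 1 / ε + ∑ k : Fin d, ((h (k + 1) : ℝ) + opNorm (θ k)))

/-- A path that consists of `n` line segments (possibly constant ones). -/
def HasSegments {V : Type*} [TopologicalSpace V] [AddCommGroup V] [Module ℝ V] {a b : V}
    (n : ℕ) (γ : Path a b) : Prop :=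
  ∃ τ : Fin (n + 1) → ℝ, StrictMono τ ∧ τ 0 = 0 ∧ τ (Fin.last n) = 1 ∧
    ∀ k : Fin n, ∀ u ∈ Icc (0 : ℝ) 1,
      γ.extend ((1 - u) * τ k.castSucc + u * τ k.succ) =
        (1 - u) • γ.extend (τ k.castSucc) + u • γ.extend (τ k.succ)

end DeepNet

end

/-!
Let `θ̂` be a dropout of `θ`. Along the segment from `θ` to `θ̂` noise stability bounds the change
of the output by the norms of random sums: the centred dropout factors times the columns of the
weight matrices, pushed forward by the Jacobians. Revealing the factors one at a time turns
`√(1 + ‖·‖²)` of such a sum into a process with an exponential supermartingale bound, which, unlike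
a coordinatewise estimate, does not depend on the dimension. A union bound over layers, inputs and
a fine grid of points of the segment leaves a dropout that is good on the whole segment and kills
at least `h*_k` units in every hidden layer `k`.

Dead units leave room for `θ*`. Both dead networks reach a copy of `θ*` embedded in their dead
units by segments on which either nothing that the output sees changes, or only the output layer
does, so that the loss is convex there; the two copies of `θ*` are joined by segments of embeddings
of `θ*`. If the admissible error exceeds `β max ‖f_θ‖`, scaling `θ` to zero replaces dropout.
-/

noncomputable section

namespace DeepNet

section LinearAlgebra

variable {n m q : ℕ}

lemma mulE_apply (A : Matrix (Fin m) (Fin n) ℝ) (v : E n) (r : Fin m) :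
    mulE A v r = ∑ j, A r j * v j := rfl

lemma mulE_mul (A : Matrix (Fin m) (Fin n) ℝ) (B : Matrix (Fin n) (Fin q) ℝ) (v : E q) :
    mulE (A * B) v = mulE A (mulE B v) := by
  simp [mulE, Matrix.mulVec_mulVec]

lemma mulE_add_left (A B : Matrix (Fin m) (Fin n) ℝ) (v : E n) :
    mulE (A + B) v = mulE A v + mulE B v := by
  simp [mulE, Matrix.add_mulVec]

lemma mulE_smul_left (a : ℝ) (A : Matrix (Fin m) (Fin n) ℝ) (v : E n) :
    mulE (a • A) v = a • mulE A v := by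
  simp [mulE, Matrix.smul_mulVec]

lemma mulE_smul_right (a : ℝ) (A : Matrix (Fin m) (Fin n) ℝ) (v : E n) :
    mulE A (a • v) = a • mulE A v := by
  simp [mulE, Matrix.mulVec_smul]

lemma mulE_one (v : E n) : mulE (1 : Matrix (Fin n) (Fin n) ℝ) v = v := by
  simp [mulE]

lemma mulE_eq_sum_single (A : Matrix (Fin m) (Fin n) ℝ) (v : E n) :
    mulE A v = ∑ c, v c • mulE A (EuclideanSpace.single c 1) := by
  ext r
  simp [mulE_apply, mul_comm]

lemma norm_mulE_single (A : Matrix (Fin m) (Fin n) ℝ) (c : Fin n) :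
    ‖mulE A (EuclideanSpace.single c 1)‖ = colNorm A c := by
  rw [EuclideanSpace.norm_eq, colNorm]
  simp [mulE_apply]

lemma colNorm_nonneg (A : Matrix (Fin m) (Fin n) ℝ) (c : Fin n) : 0 ≤ colNorm A c :=
  Real.sqrt_nonneg _

lemma frob_sq (A : Matrix (Fin m) (Fin n) ℝ) : frob A ^ 2 = ∑ c, colNorm A c ^ 2 := by
  rw [frob, Real.sq_sqrt (by positivity), Finset.sum_comm]
  exact Finset.sum_congr rfl fun c _ => (Real.sq_sqrt (by positivity)).symm

lemma opNorm_nonneg (A : Matrix (Fin m) (Fin n) ℝ) : 0 ≤ opNorm A := norm_nonneg _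

lemma norm_mulE_le (A : Matrix (Fin m) (Fin n) ℝ) (v : E n) : ‖mulE A v‖ ≤ opNorm A * ‖v‖ :=
  (LinearMap.toContinuousLinearMap (Matrix.toLpLin 2 2 A)).le_opNorm v

lemma norm_le_norm_of_abs_le {v w : E n} (H : ∀ j, |v j| ≤ |w j|) : ‖v‖ ≤ ‖w‖ := by
  rw [EuclideanSpace.norm_eq, EuclideanSpace.norm_eq]
  exact Real.sqrt_le_sqrt <| Finset.sum_le_sum fun j _ =>
    pow_le_pow_left₀ (norm_nonneg _) (H j) 2

lemma norm_mulE_le_of_scaled_columns {A B : Matrix (Fin m) (Fin n) ℝ} {e : Fin n → ℝ} {M : ℝ}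
    (hM : 0 ≤ M) (he : ∀ c, |e c| ≤ M) (hB : ∀ r c, B r c = e c * A r c) (v : E n) :
    ‖mulE B v‖ ≤ opNorm A * (M * ‖v‖) := by
  let w : E n := WithLp.toLp 2 fun c => e c * v c
  have hBA : mulE B v = mulE A w := by
    ext r
    rw [mulE_apply, mulE_apply]
    exact Finset.sum_congr rfl fun c _ => by simp only [hB, w]; ring
  have hw : ‖w‖ ≤ M * ‖v‖ := by
    rw [← Real.norm_of_nonneg hM, ← norm_smul]
    refine norm_le_norm_of_abs_le fun c => ?_
    simp only [w, PiLp.smul_apply, smul_eq_mul, abs_mul, abs_of_nonneg hM]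
    exact mul_le_mul_of_nonneg_right (he c) (abs_nonneg _)
  exact hBA ▸ (norm_mulE_le A w).trans (mul_le_mul_of_nonneg_left hw (opNorm_nonneg A))

end LinearAlgebra

section Activation

variable {n k : ℕ}

lemma relu_apply (v : E n) (j : Fin n) : relu v j = max (v j) 0 := rfl

lemma relu_smul {a : ℝ} (ha : 0 ≤ a) (v : E n) : relu (a • v) = a • relu v := by
  ext j
  simp only [relu_apply, PiLp.smul_apply, smul_eq_mul]
  rw [mul_max_of_nonneg _ _ ha, mul_zero]

lemma norm_relu_sub_le (v w : E n) : ‖relu v - relu w‖ ≤ ‖v - w‖ :=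
  norm_le_norm_of_abs_le fun _ => abs_max_sub_max_le_abs _ _ _

lemma norm_relu_le (v : E n) : ‖relu v‖ ≤ ‖v‖ := by
  have hzero : relu (0 : E n) = 0 := by simpa using relu_smul le_rfl (0 : E n)
  simpa [hzero] using norm_relu_sub_le v 0

lemma act_of_pos (hk : 1 ≤ k) (v : E n) : act k v = relu v := by
  obtain ⟨k, rfl⟩ := Nat.exists_eq_add_of_le' hk
  rfl

lemma act_apply_congr {v w : E n} {j : Fin n} (hj : v j = w j) : act k v j = act k w j := by
  cases k with
  | zero => exact hj
  | succ k => simp only [act, relu_apply, hj]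

lemma act_smul {a : ℝ} (ha : 0 ≤ a) (v : E n) : act k (a • v) = a • act k v := by
  cases k with
  | zero => rfl
  | succ k => exact relu_smul ha v

lemma norm_act_le (v : E n) : ‖act k v‖ ≤ ‖v‖ := by
  cases k with
  | zero => exact le_rfl
  | succ k => exact norm_relu_le v

lemma norm_act_sub_le (v w : E n) : ‖act k v - act k w‖ ≤ ‖v - w‖ := by
  cases k with
  | zero => exact le_rfl
  | succ k => exact norm_relu_sub_le v w

end Activation

section Network

variable {d : ℕ} {h : ℕ → ℕ} {θ θ' : Params d h} {k : ℕ}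

lemma layer_of_lt (θ : Params d h) (hk : k < d) (v : E (h k)) :
    layer θ k v = mulE (θ ⟨k, hk⟩) (act k v) :=
  dif_pos hk

lemma layer_smul (θ : Params d h) {a : ℝ} (ha : 0 ≤ a) (v : E (h k)) :
    layer θ k (a • v) = a • layer θ k v := by
  by_cases hk : k < d
  · rw [layer_of_lt θ hk, layer_of_lt θ hk, act_smul ha, mulE_smul_right]
  · simp [layer, hk]

lemma pre_succ (θ : Params d h) (x : E (h 0)) (hk : k < d) :
    pre θ x (k + 1) = mulE (θ ⟨k, hk⟩) (act k (pre θ x k)) :=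
  layer_of_lt θ hk _

lemma pre_smul (x : E (h 0)) {a : ℝ} (ha : 0 ≤ a) (hk : k ≤ d) :
    pre (a • θ) x k = a ^ k • pre θ x k := by
  induction k with
  | zero => simp [pre]
  | succ k ih =>
    rw [pre_succ _ x hk, pre_succ _ x hk, ih (Nat.le_of_succ_le hk), act_smul (pow_nonneg ha k),
      mulE_smul_right, Pi.smul_apply, mulE_smul_left, smul_smul, pow_succ]

lemma pre_congr (x : E (h 0)) (H : ∀ i : Fin d, (i : ℕ) < k → θ i = θ' i) :
    pre θ x k = pre θ' x k := by
  induction k with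
  | zero => rfl
  | succ k ih =>
    have hprev : pre θ x k = pre θ' x k := ih fun i hi => H i (hi.trans k.lt_succ_self)
    by_cases hk : k < d
    · rw [pre_succ θ x hk, pre_succ θ' x hk, hprev, H ⟨k, hk⟩ k.lt_succ_self]
    · simp [pre, layer, hk]

lemma pre_apply_eq_of_rows_eq_off (x : E (h 0)) (D : ∀ k, Set (Fin (h k)))
    (hrow : ∀ k : Fin d, ∀ r ∉ D (k + 1), ∀ j, θ k r j = θ' k r j)
    (hzero : ∀ k : Fin d, 1 ≤ (k : ℕ) → ∀ r ∉ D (k + 1), ∀ j ∈ D k, θ k r j = 0) (hk : k ≤ d)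
    {r : Fin (h k)} (hr : r ∉ D k) : pre θ x k r = pre θ' x k r := by
  induction k with
  | zero => rfl
  | succ k ih =>
    rw [pre_succ θ x hk, pre_succ θ' x hk, mulE_apply, mulE_apply]
    refine Finset.sum_congr rfl fun j _ => ?_
    rcases k.eq_zero_or_pos with rfl | hk0
    · rw [hrow ⟨0, hk⟩ r hr j]
      rfl
    · by_cases hj : j ∈ D k
      · rw [← hrow ⟨k, hk⟩ r hr j, hzero ⟨k, hk⟩ hk0 r hr j hj, zero_mul, zero_mul]
      · rw [hrow ⟨k, hk⟩ r hr j, act_apply_congr (ih (Nat.le_of_succ_le hk) hj)]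

lemma net_eq_of_rows_eq_off (x : E (h 0)) (D : ∀ k, Set (Fin (h k))) (hDd : D d = ∅)
    (hrow : ∀ k : Fin d, ∀ r ∉ D (k + 1), ∀ j, θ k r j = θ' k r j)
    (hzero : ∀ k : Fin d, 1 ≤ (k : ℕ) → ∀ r ∉ D (k + 1), ∀ j ∈ D k, θ k r j = 0) :
    net θ x = net θ' x := by
  ext r
  exact pre_apply_eq_of_rows_eq_off x D hrow hzero le_rfl (by simp [hDd])

lemma net_lineMap_of_eq_below_last (x : E (h 0))
    (H : ∀ k : Fin d, (k : ℕ) + 1 < d → θ k = θ' k) (hd : 1 ≤ d) (u : ℝ) :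
    net ((1 - u) • θ + u • θ') x = (1 - u) • net θ x + u • net θ' x := by
  obtain ⟨d, rfl⟩ := Nat.exists_eq_add_of_le' hd
  have hmix : pre ((1 - u) • θ + u • θ') x d = pre θ x d := pre_congr x fun k hk => by
    rw [Pi.add_apply, Pi.smul_apply, Pi.smul_apply, ← H k (by omega), ← add_smul, sub_add_cancel,
      one_smul]
  have hθ' : pre θ' x d = pre θ x d := pre_congr x fun k hk => (H k (by omega)).symm
  simp only [net, pre_succ _ x d.lt_succ_self, hmix, hθ', Pi.add_apply, Pi.smul_apply,
    mulE_add_left, mulE_smul_left]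

end Network

section Embedding

variable {d : ℕ} {h hstar : ℕ → ℕ}

/-- The network that writes the neurons of `θ` at the places described by `α` and reads them at
the places described by `β`. -/
def emb (α β : ∀ k, Matrix (Fin (h k)) (Fin (hstar k)) ℝ) (θ : Params d hstar) : Params d h :=
  fun k => α (k + 1) * θ k * (β k).transpose

/-- A hidden layer written by `α` and read by `β` carries the same activations as the layer of the
embedded network. -/
def ReadsBack {a b : ℕ} (α β : Matrix (Fin a) (Fin b) ℝ) : Prop :=
  ∀ v : E b, mulE β.transpose (relu (mulE α v)) = relu v

/-- The matrices `α` and `β` describe an embedding of networks of depth `d` and widths `hstar` into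
networks of widths `h` that preserves the computed function. -/
structure IsEmbedding (d : ℕ) (hin : hstar 0 = h 0) (hout : hstar d = h d)
    (α β : ∀ k, Matrix (Fin (h k)) (Fin (hstar k)) ℝ) : Prop where
  input : ∀ x, mulE (β 0).transpose x = castE hin.symm x
  hidden : ∀ k, 1 ≤ k → k < d → ReadsBack (α k) (β k)
  output : ∀ v, mulE (α d) v = castE hout v

lemma emb_lineMap_left (α α' β : ∀ k, Matrix (Fin (h k)) (Fin (hstar k)) ℝ) (θ : Params d hstar)
    (u : ℝ) : (1 - u) • emb α β θ + u • emb α' β θ = emb ((1 - u) • α + u • α') β θ := by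
  funext k
  simp [emb, Matrix.add_mul]

lemma emb_lineMap_right (α β β' : ∀ k, Matrix (Fin (h k)) (Fin (hstar k)) ℝ) (θ : Params d hstar)
    (u : ℝ) : (1 - u) • emb α β θ + u • emb α β' θ = emb α ((1 - u) • β + u • β') θ := by
  funext k
  simp [emb, Matrix.mul_add]

lemma IsEmbedding.pre_emb {hin : hstar 0 = h 0} {hout : hstar d = h d}
    {α β : ∀ k, Matrix (Fin (h k)) (Fin (hstar k)) ℝ} (H : IsEmbedding d hin hout α β)
    (θ : Params d hstar) (x : E (h 0)) {k : ℕ} (hk : 1 ≤ k) (hkd : k ≤ d) :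
    pre (emb α β θ) x k = mulE (α k) (pre θ (castE hin.symm x) k) := by
  induction k, hk using Nat.le_induction with
  | base =>
    rw [pre_succ _ x hkd, pre_succ _ _ hkd]
    simp only [emb, mulE_mul, act, pre]
    rw [H.input]
  | succ k hk ih =>
    rw [pre_succ _ x hkd, pre_succ _ _ hkd, ih (Nat.le_of_succ_le hkd)]
    simp only [emb, mulE_mul, act_of_pos hk]
    rw [H.hidden k hk hkd]

lemma IsEmbedding.net_emb {hin : hstar 0 = h 0} {hout : hstar d = h d}
    {α β : ∀ k, Matrix (Fin (h k)) (Fin (hstar k)) ℝ} (H : IsEmbedding d hin hout α β)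
    (hd : 1 ≤ d) (θ : Params d hstar) (x : E (h 0)) :
    net (emb α β θ) x = castE hout (net θ (castE hin.symm x)) := by
  rw [net, H.pre_emb θ x hd le_rfl, H.output, net]

end Embedding

section Placement

lemma relu_mulE_of_single_entry_rows {a b : ℕ} {α : Matrix (Fin a) (Fin b) ℝ}
    (hpos : ∀ r j, 0 ≤ α r j) (huniq : ∀ r j j', α r j ≠ 0 → α r j' ≠ 0 → j = j') (v : E b) :
    relu (mulE α v) = mulE α (relu v) := by
  ext r
  simp only [relu_apply, mulE_apply]
  by_cases H : ∃ j, α r j ≠ 0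
  · obtain ⟨j, hj⟩ := H
    have hzero : ∀ j' ≠ j, α r j' = 0 := fun j' hj' => of_not_not fun h => hj' (huniq r j' j h hj)
    rw [Finset.sum_eq_single j (fun j' _ hj' => by rw [hzero j' hj', zero_mul]) (by simp),
      Finset.sum_eq_single j (fun j' _ hj' => by rw [hzero j' hj', zero_mul]) (by simp),
      mul_max_of_nonneg _ _ (hpos r j), mul_zero]
  · push Not at H
    simp [H]

lemma readsBack_of_transpose_mul_eq_one {a b : ℕ} {α β : Matrix (Fin a) (Fin b) ℝ}
    (hpos : ∀ r j, 0 ≤ α r j) (huniq : ∀ r j j', α r j ≠ 0 → α r j' ≠ 0 → j = j')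
    (hone : β.transpose * α = 1) : ReadsBack α β := fun v => by
  rw [relu_mulE_of_single_entry_rows hpos huniq, ← mulE_mul, hone, mulE_one]

/-- The `0`-`1` matrix of the identification of neurons with equal numbers. -/
def castMatrix (a b : ℕ) : Matrix (Fin a) (Fin b) ℝ :=
  Matrix.of fun r j => if (r : ℕ) = j then 1 else 0

lemma mulE_castMatrix {a b : ℕ} (e : b = a) (v : E b) : mulE (castMatrix a b) v = castE e v := by
  subst e
  ext r
  simp [mulE_apply, castMatrix, castE, Fin.val_inj]

lemma transpose_castMatrix (a b : ℕ) : (castMatrix a b).transpose = castMatrix b a := by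
  ext r j
  simp [castMatrix, eq_comm]

variable {ι κ : Type*}

/-- Two injections of neurons that collide only where they agree. -/
structure Compatible (σ τ : ι → κ) : Prop where
  injective_left : Function.Injective σ
  injective_right : Function.Injective τ
  eq_of_eq : ∀ i j, σ i = τ j → i = j

lemma Compatible.symm {σ τ : ι → κ} (H : Compatible σ τ) : Compatible τ σ :=
  ⟨H.injective_right, H.injective_left, fun i j hij => (H.eq_of_eq j i hij.symm).symm⟩

lemma exists_compatible [Fintype ι] (S T : Finset κ) (hS : Fintype.card ι ≤ S.card)
    (hT : Fintype.card ι ≤ T.card) :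
    ∃ σ τ : ι → κ, Compatible σ τ ∧ (∀ j, σ j ∈ S) ∧ ∀ j, τ j ∈ T := by
  classical
  obtain ⟨T', hT', hcard⟩ := Finset.exists_subset_card_eq hT
  obtain ⟨σ⟩ : Nonempty (ι ↪ S) := Function.Embedding.nonempty_of_card_le (by simpa using hS)
  have hσ : Function.Injective fun j => (σ j : κ) := Subtype.val_injective.comp σ.injective
  -- `τ` extends the part of `σ` that already takes values in `T'`.
  obtain ⟨τ, hτ⟩ := Finset.exists_equiv_extend_of_card_eq hcard.symm
    (s := Finset.univ.filter fun j => (σ j : κ) ∈ T') (f := fun j => (σ j : κ))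
    (Finset.image_subset_iff.2 fun j hj => (Finset.mem_filter.1 hj).2) hσ.injOn
  refine ⟨fun j => σ j, fun j => τ j, ⟨hσ, Subtype.val_injective.comp τ.injective,
    fun i j hij => ?_⟩, fun j => (σ j).2, fun j => hT' (τ j).2⟩
  have hi : (σ i : κ) ∈ T' := hij ▸ (τ j).2
  exact τ.injective (Subtype.val_injective ((hτ i (by simpa using hi)).trans hij))

variable [DecidableEq κ]

/-- The `0`-`1` matrix of a map `σ` of neurons. -/
def mapMatrix (σ : ι → κ) : Matrix κ ι ℝ := Matrix.of fun r j => if r = σ j then 1 else 0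

/-- The `0`-`1` matrix of the union of the graphs of two maps of neurons: it writes every neuron
both at its place under `σ` and at its place under `τ`. -/
def unionMatrix (σ τ : ι → κ) : Matrix κ ι ℝ :=
  Matrix.of fun r j => if r = σ j ∨ r = τ j then 1 else 0

lemma unionMatrix_comm (σ τ : ι → κ) : unionMatrix σ τ = unionMatrix τ σ := by
  ext r j
  simp [unionMatrix, or_comm]

lemma transpose_mapMatrix_mul_apply [Fintype κ] (σ : ι → κ) (A : Matrix κ ι ℝ) (i j : ι) :
    ((mapMatrix σ).transpose * A) i j = A (σ i) j := by
  simp [Matrix.mul_apply, mapMatrix]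

namespace Compatible

variable {σ τ : ι → κ}

lemma transpose_mapMatrix_mul_unionMatrix [Fintype κ] [DecidableEq ι] (H : Compatible σ τ) :
    (mapMatrix σ).transpose * unionMatrix σ τ = 1 := by
  ext i j
  rw [transpose_mapMatrix_mul_apply, Matrix.one_apply]
  exact if_congr ⟨fun h => h.elim (@H.injective_left _ _) (H.eq_of_eq _ _),
    fun h => Or.inl (congrArg σ h)⟩ rfl rfl

lemma transpose_mapMatrix_mul_mapMatrix [Fintype κ] [DecidableEq ι] (H : Compatible σ τ) :
    (mapMatrix σ).transpose * mapMatrix σ = 1 := by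
  ext i j
  rw [transpose_mapMatrix_mul_apply, Matrix.one_apply]
  exact if_congr H.injective_left.eq_iff rfl rfl

lemma eq_of_unionMatrix_ne_zero (H : Compatible σ τ) (r : κ) (j j' : ι)
    (hj : unionMatrix σ τ r j ≠ 0) (hj' : unionMatrix σ τ r j' ≠ 0) : j = j' := by
  simp only [unionMatrix, Matrix.of_apply, ne_eq, ite_eq_right_iff, one_ne_zero, imp_false,
    not_not] at hj hj'
  rcases hj with h | h <;> rcases hj' with h' | h'
  · exact H.injective_left (h.symm.trans h')
  · exact H.eq_of_eq _ _ (h.symm.trans h')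
  · exact (H.eq_of_eq _ _ (h'.symm.trans h)).symm
  · exact H.injective_right (h.symm.trans h')

lemma readsBack_write {a b : ℕ} {σ τ : Fin b → Fin a} (H : Compatible σ τ) {u : ℝ}
    (hu : u ∈ Icc (0 : ℝ) 1) :
    ReadsBack ((1 - u) • mapMatrix σ + u • unionMatrix σ τ) (mapMatrix σ) := by
  refine readsBack_of_transpose_mul_eq_one (fun r j => ?_) (fun r j j' hj hj' => ?_) ?_
  · have hmap : 0 ≤ mapMatrix σ r j := by simp only [mapMatrix, Matrix.of_apply]; positivity
    have hunion : 0 ≤ unionMatrix σ τ r j := by simp only [unionMatrix, Matrix.of_apply]; positivity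
    exact add_nonneg (mul_nonneg (sub_nonneg.2 hu.2) hmap) (mul_nonneg hu.1 hunion)
  · have hle : ∀ i, unionMatrix σ τ r i = 0 →
        ((1 - u) • mapMatrix σ + u • unionMatrix σ τ) r i = 0 := fun i hi => by
      have hne : ¬(r = σ i ∨ r = τ i) := by simpa [unionMatrix] using hi
      simp [mapMatrix, unionMatrix, not_or.1 hne]
    exact H.eq_of_unionMatrix_ne_zero r j j' (mt (hle j) hj) (mt (hle j') hj')
  · rw [Matrix.mul_add, Matrix.mul_smul, Matrix.mul_smul, H.transpose_mapMatrix_mul_unionMatrix,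
      H.transpose_mapMatrix_mul_mapMatrix, ← add_smul, sub_add_cancel, one_smul]

lemma readsBack_read {a b : ℕ} {σ τ : Fin b → Fin a} (H : Compatible σ τ) (u : ℝ) :
    ReadsBack (unionMatrix σ τ) ((1 - u) • mapMatrix σ + u • mapMatrix τ) := by
  refine readsBack_of_transpose_mul_eq_one (fun r j => ?_) H.eq_of_unionMatrix_ne_zero ?_
  · simp only [unionMatrix, Matrix.of_apply]
    positivity
  · have hτ := H.symm.transpose_mapMatrix_mul_unionMatrix
    rw [unionMatrix_comm] at hτ
    rw [Matrix.transpose_add, Matrix.transpose_smul, Matrix.transpose_smul, Matrix.add_mul,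
      Matrix.smul_mul, Matrix.smul_mul, H.transpose_mapMatrix_mul_unionMatrix, hτ, ← add_smul,
      sub_add_cancel, one_smul]

end Compatible

lemma exists_readsBack {a b : ℕ} (S T : Finset (Fin a)) (hS : b ≤ S.card) (hT : b ≤ T.card) :
    ∃ P Q R : Matrix (Fin a) (Fin b) ℝ,
      (∀ r ∉ S, ∀ j, P r j = 0) ∧ (∀ r ∉ T, ∀ j, Q r j = 0) ∧
      ∀ u ∈ Icc (0 : ℝ) 1, ReadsBack ((1 - u) • P + u • R) P ∧
        ReadsBack R ((1 - u) • P + u • Q) ∧ ReadsBack ((1 - u) • Q + u • R) Q := by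
  obtain ⟨σ, τ, H, hσ, hτ⟩ := exists_compatible (ι := Fin b) S T (by simpa) (by simpa)
  refine ⟨mapMatrix σ, mapMatrix τ, unionMatrix σ τ, fun r hr j => ?_, fun r hr j => ?_,
    fun u hu => ⟨H.readsBack_write hu, H.readsBack_read u, ?_⟩⟩
  · exact if_neg fun h : r = σ j => hr (h ▸ hσ j)
  · exact if_neg fun h : r = τ j => hr (h ▸ hτ j)
  · exact unionMatrix_comm σ τ ▸ H.symm.readsBack_write hu

variable {d : ℕ} {h hstar : ℕ → ℕ}

lemma exists_isEmbedding (hin : hstar 0 = h 0) (hout : hstar d = h d)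
    (S T : ∀ k, Finset (Fin (h k))) (hS : ∀ k, 1 ≤ k → k < d → hstar k ≤ (S k).card)
    (hT : ∀ k, 1 ≤ k → k < d → hstar k ≤ (T k).card) :
    ∃ P Q R : ∀ k, Matrix (Fin (h k)) (Fin (hstar k)) ℝ,
      (∀ k, 1 ≤ k → k < d → ∀ r ∉ S k, ∀ j, P k r j = 0) ∧
      (∀ k, 1 ≤ k → k < d → ∀ r ∉ T k, ∀ j, Q k r j = 0) ∧
      ∀ u ∈ Icc (0 : ℝ) 1, IsEmbedding d hin hout ((1 - u) • P + u • R) P ∧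
        IsEmbedding d hin hout R ((1 - u) • P + u • Q) ∧
        IsEmbedding d hin hout ((1 - u) • Q + u • R) Q := by
  have hlayer : ∀ k, ∃ P Q R : Matrix (Fin (h k)) (Fin (hstar k)) ℝ,
      (1 ≤ k → k < d → (∀ r ∉ S k, ∀ j, P r j = 0) ∧ (∀ r ∉ T k, ∀ j, Q r j = 0) ∧
        ∀ u ∈ Icc (0 : ℝ) 1, ReadsBack ((1 - u) • P + u • R) P ∧
          ReadsBack R ((1 - u) • P + u • Q) ∧ ReadsBack ((1 - u) • Q + u • R) Q) ∧
      (¬(1 ≤ k ∧ k < d) → P = castMatrix _ _ ∧ Q = castMatrix _ _ ∧ R = castMatrix _ _) := by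
    intro k
    by_cases hk : 1 ≤ k ∧ k < d
    · obtain ⟨P, Q, R, H⟩ := exists_readsBack (S k) (T k) (hS k hk.1 hk.2) (hT k hk.1 hk.2)
      exact ⟨P, Q, R, fun _ _ => H, fun hk' => absurd hk hk'⟩
    · exact ⟨_, _, _, fun h1 h2 => absurd ⟨h1, h2⟩ hk, fun _ => ⟨rfl, rfl, rfl⟩⟩
  choose P Q R hhidden hcast using hlayer
  obtain ⟨hP0, hQ0, -⟩ := hcast 0 (by simp)
  obtain ⟨hPd, hQd, hRd⟩ := hcast d (by simp)
  have hmix : ∀ {a b : ℕ} (A : Matrix (Fin a) (Fin b) ℝ) (u : ℝ), (1 - u) • A + u • A = A :=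
    fun A u => by rw [← add_smul, sub_add_cancel, one_smul]
  have hreads : ∀ x, mulE (castMatrix (h 0) (hstar 0)).transpose x = castE hin.symm x := fun x => by
    rw [transpose_castMatrix, mulE_castMatrix]
  refine ⟨P, Q, R, fun k h1 h2 => (hhidden k h1 h2).1, fun k h1 h2 => (hhidden k h1 h2).2.1,
    fun u hu => ⟨⟨?_, fun k h1 h2 => ((hhidden k h1 h2).2.2 u hu).1, ?_⟩,
      ⟨?_, fun k h1 h2 => ((hhidden k h1 h2).2.2 u hu).2.1, ?_⟩,
      ⟨?_, fun k h1 h2 => ((hhidden k h1 h2).2.2 u hu).2.2, ?_⟩⟩⟩ <;>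
  simp only [Pi.add_apply, Pi.smul_apply, hP0, hQ0, hPd, hQd, hRd, hmix] <;>
  first | exact hreads | exact mulE_castMatrix hout

end Placement

section PolygonalPath

variable {V : Type*} [AddCommGroup V] [Module ℝ V] {n : ℕ}

lemma segment_subset_iff_forall {v w : V} {S : Set V} :
    segment ℝ v w ⊆ S ↔ ∀ u ∈ Icc (0 : ℝ) 1, (1 - u) • v + u • w ∈ S := by
  rw [segment_eq_image, image_subset_iff]
  rfl

/-- The polygonal curve through `v 0, …, v n` that is at the vertex `v k` at time `k`. -/
def polyline (n : ℕ) (v : ℕ → V) (s : ℝ) : V :=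
  v 0 + ∑ k ∈ Finset.range n, max 0 (min (s - k) 1) • (v (k + 1) - v k)

lemma polyline_add (v : ℕ → V) {k : ℕ} (hk : k < n) {u : ℝ} (hu : u ∈ Icc (0 : ℝ) 1) :
    polyline n v (k + u) = (1 - u) • v k + u • v (k + 1) := by
  have hpast : ∀ j ∈ Finset.range k,
      max 0 (min ((k : ℝ) + u - j) 1) • (v (j + 1) - v j) = v (j + 1) - v j := fun j hj => by
    have : (j : ℝ) + 1 ≤ k := by exact_mod_cast Finset.mem_range.1 hj
    rw [min_eq_right (by linarith [hu.1]), max_eq_right zero_le_one, one_smul]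
  have hfuture : ∀ j ∈ Finset.range n, j ∉ Finset.range (k + 1) →
      max 0 (min ((k : ℝ) + u - j) 1) • (v (j + 1) - v j) = 0 := fun j _ hj => by
    have : (k : ℝ) + 1 ≤ j := by exact_mod_cast not_lt.1 (mt Finset.mem_range.2 hj)
    rw [max_eq_left ((min_le_left _ _).trans (by linarith [hu.2])), zero_smul]
  rw [polyline, ← Finset.sum_subset (Finset.range_subset_range.2 hk) hfuture,
    Finset.sum_range_succ, Finset.sum_congr rfl hpast, Finset.sum_range_sub, add_sub_cancel_left,
    min_eq_left hu.2, max_eq_right hu.1]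
  module

lemma polyline_natCast (v : ℕ → V) {k : ℕ} (hk : k ≤ n) : polyline n v k = v k := by
  rcases k with _ | k
  · rcases n.eq_zero_or_pos with rfl | hn
    · simp [polyline]
    · simpa using polyline_add v hn (left_mem_Icc.2 zero_le_one)
  · simpa using polyline_add v hk (right_mem_Icc.2 zero_le_one)

lemma polyline_mem {v : ℕ → V} {S : Set V} (hn : n ≠ 0)
    (H : ∀ k < n, segment ℝ (v k) (v (k + 1)) ⊆ S) {s : ℝ} (hs : s ∈ Icc (0 : ℝ) n) :
    polyline n v s ∈ S := by
  rcases hs.2.lt_or_eq with hlt | rfl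
  · have hk : ⌊s⌋₊ < n := (Nat.floor_lt hs.1).2 hlt
    have hu : s - ⌊s⌋₊ ∈ Icc (0 : ℝ) 1 :=
      ⟨sub_nonneg.2 (Nat.floor_le hs.1), by linarith [Nat.lt_floor_add_one s]⟩
    rw [← add_sub_cancel (⌊s⌋₊ : ℝ) s, polyline_add v hk hu]
    exact segment_subset_iff_forall.1 (H _ hk) _ hu
  · obtain ⟨k, rfl⟩ := Nat.exists_eq_succ_of_ne_zero hn
    rw [polyline_natCast v le_rfl]
    exact H k k.lt_succ_self (right_mem_segment ℝ _ _)

variable [TopologicalSpace V] [ContinuousAdd V] [ContinuousSMul ℝ V]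

lemma continuous_polyline (n : ℕ) (v : ℕ → V) : Continuous (polyline n v) :=
  continuous_const.add <| continuous_finsetSum _ fun _ _ =>
    Continuous.smul (by fun_prop) continuous_const

lemma exists_path_of_segments_subset {v : ℕ → V} {S : Set V} (hn : n ≠ 0)
    (H : ∀ k < n, segment ℝ (v k) (v (k + 1)) ⊆ S) :
    ∃ γ : Path (v 0) (v n), HasSegments n γ ∧ ∀ t, γ t ∈ S := by
  have hn0 : (0 : ℝ) < n := by exact_mod_cast hn.bot_lt
  let γ : Path (v 0) (v n) :=
    { toFun := fun t => polyline n v (n * t)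
      continuous_toFun := (continuous_polyline n v).comp (by fun_prop)
      source' := by simpa using polyline_natCast v n.zero_le
      target' := by simpa using polyline_natCast v le_rfl }
  have hγ : ∀ s ∈ Icc (0 : ℝ) n, γ.extend (s / n) = polyline n v s := fun s hs => by
    rw [Path.extend_apply _ ⟨div_nonneg hs.1 hn0.le, (div_le_one hn0).2 hs.2⟩]
    exact congrArg (polyline n v) (mul_div_cancel₀ s hn0.ne')
  have hvertex : ∀ k ≤ n, γ.extend ((k : ℝ) / n) = v k := fun k hk => by
    rw [hγ k ⟨k.cast_nonneg, Nat.cast_le.2 hk⟩, polyline_natCast v hk]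
  refine ⟨γ, ⟨fun k => (k : ℕ) / n, fun a b hab => ?_, by simp, by simp [hn0.ne'],
    fun k u hu => ?_⟩, fun t => ?_⟩
  · exact div_lt_div_of_pos_right (by exact_mod_cast hab) hn0
  · have hk : ((k : ℕ) : ℝ) + 1 ≤ n := by exact_mod_cast k.2
    have hpoint : (1 - u) * ((k.castSucc : ℕ) / n : ℝ) + u * ((k.succ : ℕ) / n) =
        ((k : ℕ) + u) / n := by
      simp only [Fin.val_castSucc, Fin.val_succ, Nat.cast_add, Nat.cast_one]
      ring
    rw [hpoint, hvertex _ k.castSucc.is_le, hvertex _ k.succ.is_le,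
      hγ _ ⟨add_nonneg (Nat.cast_nonneg _) hu.1, by linarith [hu.2]⟩]
    exact polyline_add v k.2 hu
  · exact polyline_mem hn H ⟨mul_nonneg hn0.le t.2.1, mul_le_of_le_one_right hn0.le t.2.2⟩

end PolygonalPath

section LossSublevel

variable {d m : ℕ} {h hstar : ℕ → ℕ}

/-- The parameters at which the empirical loss is at most `B`. -/
def lossSublevel (l : E (h d) → E (h d) → ℝ) (X : Fin m → E (h 0)) (Y : Fin m → E (h d)) (B : ℝ) :
    Set (Params d h) :=
  {θ | empLoss l X Y (net θ) ≤ B}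

/-- The neurons in the sets `D k` of the hidden layers are dead: the next layer does not read
them. -/
def DeadOn (D : ∀ k, Set (Fin (h k))) (θ : Params d h) : Prop :=
  ∀ k : Fin d, 1 ≤ (k : ℕ) → ∀ r, ∀ j ∈ D k, θ k r j = 0

/-- The network `θ` with the incoming weights of the neurons in the sets `D k` taken from `η`. -/
def replaceRows (D : ∀ k, Set (Fin (h k))) (θ η : Params d h) : Params d h := by
  classical exact fun k => Matrix.of fun r j => if r ∈ D (k + 1) then η k r j else θ k r j

variable {l : E (h d) → E (h d) → ℝ} {X : Fin m → E (h 0)} {Y : Fin m → E (h d)} {B : ℝ}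
  {θ θ' η : Params d h} {D : ∀ k, Set (Fin (h k))}

lemma lossSublevel_mono {B' : ℝ} (hB : B ≤ B') : lossSublevel l X Y B ⊆ lossSublevel l X Y B' :=
  fun _ hθ => le_trans hθ hB

lemma replaceRows_of_mem {k : Fin d} {r : Fin (h (k + 1))} (hr : r ∈ D (k + 1))
    (j : Fin (h k)) : replaceRows D θ η k r j = η k r j :=
  if_pos hr

lemma replaceRows_of_notMem {k : Fin d} {r : Fin (h (k + 1))} (hr : r ∉ D (k + 1))
    (j : Fin (h k)) : replaceRows D θ η k r j = θ k r j :=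
  if_neg hr

lemma mem_lossSublevel_iff_of_net_eq (H : ∀ x, net θ x = net θ' x) :
    θ ∈ lossSublevel l X Y B ↔ θ' ∈ lossSublevel l X Y B := by
  rw [lossSublevel, mem_ofPred_eq, mem_ofPred_eq, funext H]

lemma empLoss_lineMap_le (hl : ∀ y, ConvexOn ℝ univ (l y)) (f g : E (h 0) → E (h d)) {u : ℝ}
    (hu : u ∈ Icc (0 : ℝ) 1) :
    empLoss l X Y (fun x => (1 - u) • f x + u • g x) ≤
      (1 - u) * empLoss l X Y f + u * empLoss l X Y g := by
  have hsum : (1 - u) * empLoss l X Y f + u * empLoss l X Y g =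
      (1 / (m : ℝ)) * ∑ s, ((1 - u) * l (Y s) (f (X s)) + u * l (Y s) (g (X s))) := by
    simp only [empLoss, Finset.sum_add_distrib, ← Finset.mul_sum]
    ring
  rw [hsum]
  exact mul_le_mul_of_nonneg_left (Finset.sum_le_sum fun s _ =>
    (hl (Y s)).2 (mem_univ _) (mem_univ _) (sub_nonneg.2 hu.2) hu.1 (sub_add_cancel 1 u))
    (by positivity)

lemma segment_subset_lossSublevel_of_eq_below_last (hl : ∀ y, ConvexOn ℝ univ (l y)) (hd : 1 ≤ d)
    (H : ∀ k : Fin d, (k : ℕ) + 1 < d → θ k = θ' k) (hθ : θ ∈ lossSublevel l X Y B)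
    (hθ' : θ' ∈ lossSublevel l X Y B) : segment ℝ θ θ' ⊆ lossSublevel l X Y B := by
  refine segment_subset_iff_forall.2 fun u hu => ?_
  rw [lossSublevel, mem_ofPred_eq, funext fun x => net_lineMap_of_eq_below_last x H hd u]
  refine (empLoss_lineMap_le hl _ _ hu).trans ?_
  simpa using (convex_Iic B) (mem_Iic.2 hθ) (mem_Iic.2 hθ') (sub_nonneg.2 hu.2) hu.1
    (sub_add_cancel 1 u)

lemma segment_subset_lossSublevel_of_rows_eq_off (hDd : D d = ∅)
    (hrow : ∀ k : Fin d, ∀ r ∉ D (k + 1), ∀ j, θ k r j = θ' k r j) (hzero : DeadOn D θ)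
    (hθ : θ ∈ lossSublevel l X Y B) : segment ℝ θ θ' ⊆ lossSublevel l X Y B := by
  refine segment_subset_iff_forall.2 fun u _ =>
    (mem_lossSublevel_iff_of_net_eq fun x => ?_).1 hθ
  refine net_eq_of_rows_eq_off x D hDd (fun k r hr j => ?_) fun k hk r _ => hzero k hk r
  simp only [Pi.add_apply, Pi.smul_apply, Matrix.add_apply, Matrix.smul_apply, ← hrow k r hr j,
    ← add_smul, sub_add_cancel, one_smul]

-- First write `η` into the dead neurons, then switch the last layer, which acts affinely, and
-- finally erase the remains of `θ`, which are dead by then.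
lemma exists_segments_of_deadOn_compl (hl : ∀ y, ConvexOn ℝ univ (l y)) (hd : 1 ≤ d)
    (hθD : DeadOn D θ) (hηD : DeadOn (fun k => (D k)ᶜ) η) (hθ : θ ∈ lossSublevel l X Y B)
    (hη : η ∈ lossSublevel l X Y B) :
    ∃ θ₁ θ₂ : Params d h, segment ℝ θ θ₁ ⊆ lossSublevel l X Y B ∧
      segment ℝ θ₁ θ₂ ⊆ lossSublevel l X Y B ∧ segment ℝ θ₂ η ⊆ lossSublevel l X Y B := by
  let D₁ : ∀ k, Set (Fin (h k)) := Function.update D d ∅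
  let D₂ : ∀ k, Set (Fin (h k)) := Function.update D d univ
  have hD₁ : ∀ k ≠ d, D₁ k = D k := fun k hk => Function.update_of_ne hk _ _
  have hD₂ : ∀ k ≠ d, D₂ k = D k := fun k hk => Function.update_of_ne hk _ _
  have hwrite : segment ℝ θ (replaceRows D₁ θ η) ⊆ lossSublevel l X Y B :=
    segment_subset_lossSublevel_of_rows_eq_off (D := D₁) (Function.update_self _ _ _)
      (fun k r hr j => (replaceRows_of_notMem hr j).symm)
      (fun k hk r j hj => hθD k hk r j (hD₁ k k.2.ne ▸ hj)) hθ
  have herase : segment ℝ η (replaceRows D₂ θ η) ⊆ lossSublevel l X Y B :=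
    segment_subset_lossSublevel_of_rows_eq_off (D := fun k => (D₂ k)ᶜ)
      (by simp [D₂])
      (fun k r hr j => (replaceRows_of_mem (not_not.1 hr) j).symm)
      (fun k hk r j hj => hηD k hk r j fun hj' => hj (by rwa [hD₂ k k.2.ne])) hη
  refine ⟨_, _, hwrite, segment_subset_lossSublevel_of_eq_below_last hl hd (fun k hk => ?_)
    (hwrite (right_mem_segment ℝ _ _)) (herase (right_mem_segment ℝ _ _)),
    segment_symm ℝ η _ ▸ herase⟩
  ext r j
  by_cases hr : r ∈ D (k + 1)
  · rw [replaceRows_of_mem (hD₁ _ hk.ne ▸ hr), replaceRows_of_mem (hD₂ _ hk.ne ▸ hr)]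
  · rw [replaceRows_of_notMem (hD₁ _ hk.ne ▸ hr), replaceRows_of_notMem (hD₂ _ hk.ne ▸ hr)]

end LossSublevel

section Connect

variable {d m : ℕ} {h hstar : ℕ → ℕ} {l : E (h d) → E (h d) → ℝ} {X : Fin m → E (h 0)}
  {Y : Fin m → E (h d)} {B : ℝ}

lemma emb_mem_lossSublevel {hin : hstar 0 = h 0} {hout : hstar d = h d}
    {α β : ∀ k, Matrix (Fin (h k)) (Fin (hstar k)) ℝ} (H : IsEmbedding d hin hout α β)
    (hd : 1 ≤ d) {θstar : Params d hstar}
    (hstarB : empLoss l X Y (fun x => castE hout (net θstar (castE hin.symm x))) ≤ B) :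
    emb α β θstar ∈ lossSublevel l X Y B := by
  rwa [lossSublevel, mem_ofPred_eq, funext (H.net_emb hd θstar)]

lemma deadOn_emb {D : ∀ k, Set (Fin (h k))} {α β : ∀ k, Matrix (Fin (h k)) (Fin (hstar k)) ℝ}
    (hβ : ∀ k, 1 ≤ k → k < d → ∀ r ∈ D k, ∀ j, β k r j = 0) (θ : Params d hstar) :
    DeadOn D (emb α β θ) := fun k hk r j hj => by
  rw [emb, Matrix.mul_apply]
  exact Finset.sum_eq_zero fun b _ => by
    rw [Matrix.transpose_apply, hβ k hk k.2 j hj b, mul_zero]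

lemma exists_path_of_deadOn {θA θB θA' θB' : Params d h} {θstar : Params d hstar}
    (hin : hstar 0 = h 0) (hout : hstar d = h d) (hl : ∀ y, ConvexOn ℝ univ (l y)) (hd : 1 ≤ d)
    {DA DB : ∀ k, Finset (Fin (h k))}
    (hcardA : ∀ k, 1 ≤ k → k < d → hstar k ≤ (DA k).card)
    (hcardB : ∀ k, 1 ≤ k → k < d → hstar k ≤ (DB k).card)
    (hdeadA : DeadOn (fun k => DA k) θA') (hdeadB : DeadOn (fun k => DB k) θB')
    (hA : segment ℝ θA θA' ⊆ lossSublevel l X Y B) (hB : segment ℝ θB θB' ⊆ lossSublevel l X Y B)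
    (hstarB : empLoss l X Y (fun x => castE hout (net θstar (castE hin.symm x))) ≤ B) :
    ∃ γ : Path θA θB, HasSegments 13 γ ∧ ∀ t, γ t ∈ lossSublevel l X Y B := by
  obtain ⟨P, Q, R, hP, hQ, hemb⟩ := exists_isEmbedding hin hout DA DB hcardA hcardB
  have hPR : segment ℝ (emb P P θstar) (emb R P θstar) ⊆ lossSublevel l X Y B :=
    segment_subset_iff_forall.2 fun u hu =>
      emb_lineMap_left P R P θstar u ▸ emb_mem_lossSublevel (hemb u hu).1 hd hstarB
  have hPQ : segment ℝ (emb R P θstar) (emb R Q θstar) ⊆ lossSublevel l X Y B :=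
    segment_subset_iff_forall.2 fun u hu =>
      emb_lineMap_right R P Q θstar u ▸ emb_mem_lossSublevel (hemb u hu).2.1 hd hstarB
  have hQR : segment ℝ (emb Q Q θstar) (emb R Q θstar) ⊆ lossSublevel l X Y B :=
    segment_subset_iff_forall.2 fun u hu =>
      emb_lineMap_left Q R Q θstar u ▸ emb_mem_lossSublevel (hemb u hu).2.2 hd hstarB
  obtain ⟨A₁, A₂, hA₀₁, hA₁₂, hA₂P⟩ := exists_segments_of_deadOn_compl hl hd hdeadA
    (deadOn_emb (α := P) hP θstar) (hA (right_mem_segment ℝ _ _)) (hPR (left_mem_segment ℝ _ _))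
  obtain ⟨B₁, B₂, hB₀₁, hB₁₂, hB₂Q⟩ := exists_segments_of_deadOn_compl hl hd hdeadB
    (deadOn_emb (α := Q) hQ θstar) (hB (right_mem_segment ℝ _ _)) (hQR (left_mem_segment ℝ _ _))
  -- The last two of the thirteen segments are constant.
  let v : ℕ → Params d h
    | 0 => θA | 1 => θA' | 2 => A₁ | 3 => A₂ | 4 => emb P P θstar | 5 => emb R P θstar
    | 6 => emb R Q θstar | 7 => emb Q Q θstar | 8 => B₂ | 9 => B₁ | 10 => θB' | _ => θB
  have hrev : ∀ {θ θ' : Params d h}, segment ℝ θ θ' ⊆ lossSublevel l X Y B →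
      segment ℝ θ' θ ⊆ lossSublevel l X Y B := fun {θ θ'} H => segment_symm ℝ θ θ' ▸ H
  have hconst : segment ℝ θB θB ⊆ lossSublevel l X Y B := by
    rw [segment_same]
    exact singleton_subset_iff.2 (hB (left_mem_segment ℝ _ _))
  refine exists_path_of_segments_subset (v := v) (n := 13) (by norm_num) fun k hk => ?_
  interval_cases k
  exacts [hA, hA₀₁, hA₁₂, hA₂P, hPR, hPQ, hrev hQR, hrev hB₂Q, hrev hB₁₂, hrev hB₀₁, hrev hB,
    hconst, hconst]

end Connect

section Resampling

variable {ι : Type*} [Fintype ι] [DecidableEq ι] {α : ι → Type*} [∀ i, MeasurableSpace (α i)]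
  (μ : ∀ i, Measure (α i)) [∀ i, IsProbabilityMeasure (μ i)]

lemma measurePreserving_update (i : ι) :
    MeasurePreserving (fun z : α i × (∀ j, α j) => Function.update z.2 i z.1)
      ((μ i).prod (Measure.pi μ)) (Measure.pi μ) := by
  have hmeas : Measurable fun z : α i × (∀ j, α j) => Function.update z.2 i z.1 :=
    measurable_pi_lambda _ fun j => by
      rcases eq_or_ne j i with rfl | hj
      · simpa only [Function.update_self] using measurable_fst
      · simpa only [Function.update_of_ne hj, Function.comp_def] using
          (measurable_pi_apply j).comp measurable_snd
  refine ⟨hmeas, (Measure.pi_eq fun s hs => ?_).symm⟩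
  have hpre : (fun z : α i × (∀ j, α j) => Function.update z.2 i z.1) ⁻¹' univ.pi s =
      s i ×ˢ univ.pi (Function.update s i univ) := by
    ext z
    simp only [mem_preimage, mem_prod, mem_univ_pi]
    constructor
    · refine fun H => ⟨by simpa using H i, fun j => ?_⟩
      rcases eq_or_ne j i with rfl | hj
      · simp
      · simpa [hj] using H j
    · rintro ⟨hi, H⟩ j
      rcases eq_or_ne j i with rfl | hj
      · simpa using hi
      · simpa [hj] using H j
  rw [Measure.map_apply hmeas (.univ_pi hs), hpre, Measure.prod_prod, Measure.pi_pi,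
    ← Finset.mul_prod_erase _ _ (Finset.mem_univ i),
    ← Finset.mul_prod_erase _ _ (Finset.mem_univ i), Function.update_self, measure_univ, one_mul]
  exact congrArg _ (Finset.prod_congr rfl fun j hj => by
    rw [Function.update_of_ne (Finset.ne_of_mem_erase hj)])

end Resampling

section Bits

variable {ι : Type*} [Fintype ι] {p : ℝ}

lemma isProbabilityMeasure_bitLaw (hp₀ : 0 ≤ p) (hp₁ : p ≤ 1) :
    IsProbabilityMeasure (bitLaw p) := by
  refine ⟨?_⟩
  simp [bitLaw, ← ENNReal.ofReal_add hp₀ (sub_nonneg.2 hp₁)]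

lemma integral_bitLaw (hp₀ : 0 ≤ p) (hp₁ : p ≤ 1) (f : Bool → ℝ) :
    ∫ b, f b ∂bitLaw p = p * f true + (1 - p) * f false := by
  rw [integral_fintype .of_finite]
  simp [bitLaw, measureReal_def, hp₀, hp₁]

lemma integral_pi_bitLaw_update [DecidableEq ι] (hp₀ : 0 ≤ p) (hp₁ : p ≤ 1) (c : ι)
    (F : (ι → Bool) → ℝ) :
    ∫ ω, F ω ∂(Measure.pi fun _ => bitLaw p) =
      ∫ ω, ∫ b, F (Function.update ω c b) ∂bitLaw p ∂(Measure.pi fun _ => bitLaw p) := by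
  have := isProbabilityMeasure_bitLaw hp₀ hp₁
  have hupdate := measurePreserving_update (fun _ : ι => bitLaw p) c
  conv_lhs => rw [← hupdate.map_eq]
  rw [integral_map hupdate.measurable.aemeasurable .of_discrete, integral_prod_symm _ .of_finite]

lemma integral_pow_card_filter (hp₀ : 0 ≤ p) (hp₁ : p ≤ 1) (T : Finset ι) (a : ℝ) :
    ∫ ω : ι → Bool, a ^ (T.filter fun c => ω c = true).card ∂(Measure.pi fun _ => bitLaw p) =
      (p * a + (1 - p)) ^ T.card := by
  classical
  have := isProbabilityMeasure_bitLaw hp₀ hp₁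
  have hprod : ∀ ω : ι → Bool, a ^ (T.filter fun c => ω c = true).card =
      ∏ c, if c ∈ T ∧ ω c = true then a else 1 := fun ω => by
    rw [← Finset.prod_filter, Finset.prod_const]
    congr 2
    ext c
    simp
  have hfactor : ∀ c, ∫ b, (if c ∈ T ∧ b = true then a else 1) ∂bitLaw p =
      if c ∈ T then p * a + (1 - p) else 1 := fun c => by
    rw [integral_bitLaw hp₀ hp₁]
    split_ifs <;> simp_all
  simp only [hprod]
  rw [integral_fintype_prod_eq_prod (fun c b => if c ∈ T ∧ b = true then a else 1)]
  simp only [hfactor, Finset.prod_ite_mem, Finset.univ_inter, Finset.prod_const]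

-- Chernoff's bound for the lower tail, with the exponential moment of base `2 / 3`.
lemma measureReal_card_filter_lt_le (hp₀ : 0 ≤ p) (hp₁ : p ≤ 1) {T : Finset ι} {n : ℕ}
    (hn : 1.5 * (n : ℝ) ≤ p * T.card) :
    (Measure.pi fun _ : ι => bitLaw p).real {ω | (T.filter fun c => ω c = true).card < n} ≤
      Real.exp (-(n : ℝ) / 20) := by
  have := isProbabilityMeasure_bitLaw hp₀ hp₁
  have hmarkov : (2 / 3 : ℝ) ^ n *
      (Measure.pi fun _ : ι => bitLaw p).real {ω | (T.filter fun c => ω c = true).card < n} ≤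
      (1 - p / 3) ^ T.card := by
    have hmoment : p * (2 / 3) + (1 - p) = 1 - p / 3 := by ring
    rw [← hmoment, ← integral_pow_card_filter hp₀ hp₁ T (2 / 3 : ℝ)]
    refine le_trans ?_ (mul_meas_ge_le_integral_of_nonneg (.of_forall fun ω => by positivity)
      .of_finite ((2 / 3 : ℝ) ^ n))
    refine mul_le_mul_of_nonneg_left (measureReal_mono fun ω hω => ?_) (by positivity)
    exact pow_le_pow_of_le_one (a := (2 / 3 : ℝ)) (by norm_num) (by norm_num) (le_of_lt hω)
  have hmoment_le : (1 - p / 3) ^ T.card ≤ Real.exp (-(n : ℝ) / 2) := by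
    calc (1 - p / 3) ^ T.card ≤ Real.exp (-(p / 3)) ^ T.card :=
          pow_le_pow_left₀ (by linarith) (Real.one_sub_le_exp_neg _) _
      _ = Real.exp (-(p * T.card) / 3) := by
          rw [← Real.exp_nat_mul]
          ring_nf
      _ ≤ Real.exp (-(n : ℝ) / 2) := Real.exp_le_exp.2 (by linarith)
  have hbase : Real.exp (-(9 / 20) * n) ≤ (2 / 3 : ℝ) ^ n := by
    rw [mul_comm, Real.exp_nat_mul]
    refine pow_le_pow_left₀ (Real.exp_pos _).le ?_ _
    rw [Real.exp_neg]
    have := Real.quadratic_le_exp_of_nonneg (x := 9 / 20) (by norm_num)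
    exact inv_le_of_inv_le₀ (by norm_num) (by norm_num at this ⊢; linarith)
  have hexp : Real.exp (-(n : ℝ) / 20) = Real.exp (-(n : ℝ) / 2) / Real.exp (-(9 / 20) * n) := by
    rw [← Real.exp_sub]
    ring_nf
  rw [hexp, le_div_iff₀' (Real.exp_pos _)]
  exact (mul_le_mul_of_nonneg_right hbase measureReal_nonneg).trans (hmarkov.trans hmoment_le)

end Bits

section Concentration

variable {V : Type*} [NormedAddCommGroup V] [InnerProductSpace ℝ V] {p : ℝ}

/-- The centred dropout factor of a column. -/
def drop (p : ℝ) (b : Bool) : ℝ := (if b then 0 else 1 / (1 - p)) - 1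

lemma drop_false (hp : p ≠ 1) : drop p false = p / (1 - p) := by
  have := sub_ne_zero.2 hp.symm
  simp only [drop, Bool.false_eq_true, if_false]
  field_simp
  ring

lemma abs_drop_le (hp₀ : 0 ≤ p) (hp₁ : p ≤ 3 / 4) (b : Bool) : |drop p b| ≤ 3 := by
  cases b
  · rw [drop_false (by linarith), abs_of_nonneg (div_nonneg hp₀ (by linarith)),
      div_le_iff₀ (by linarith)]
    linarith
  · norm_num [drop]

lemma integral_drop (hp₀ : 0 ≤ p) (hp₁ : p < 1) : ∫ b, drop p b ∂bitLaw p = 0 := by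
  rw [integral_bitLaw hp₀ hp₁.le, drop_false hp₁.ne, mul_div_cancel₀ p (sub_pos.2 hp₁).ne']
  simp [drop]

lemma integral_drop_sq_le (hp₀ : 0 ≤ p) (hp₁ : p ≤ 3 / 4) :
    ∫ b, drop p b ^ 2 ∂bitLaw p ≤ 4 * p := by
  rw [integral_bitLaw hp₀ (by linarith), drop_false (by linarith), div_pow]
  have hp : 0 < 1 - p := by linarith
  have hvar : p * drop p true ^ 2 + (1 - p) * (p ^ 2 / (1 - p) ^ 2) = p / (1 - p) := by
    simp only [drop, if_true]
    field_simp
    ring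
  rw [hvar, div_le_iff₀ hp]
  nlinarith

lemma abs_inner_div_sqrt_one_add_norm_sq_le (v w : V) :
    |inner ℝ v w / √(1 + ‖v‖ ^ 2)| ≤ ‖w‖ := by
  have hf : 0 < √(1 + ‖v‖ ^ 2) := Real.sqrt_pos.2 (by positivity)
  rw [abs_div, abs_of_pos hf, div_le_iff₀ hf, mul_comm]
  exact (abs_real_inner_le_norm v w).trans
    (mul_le_mul_of_nonneg_right (Real.le_sqrt_of_sq_le (by linarith)) (norm_nonneg w))

lemma sqrt_one_add_norm_add_sq_le (v w : V) :
    √(1 + ‖v + w‖ ^ 2) ≤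
      √(1 + ‖v‖ ^ 2) + (inner ℝ v w / √(1 + ‖v‖ ^ 2) + ‖w‖ ^ 2 / 2) := by
  have hs := abs_le.1 (abs_inner_div_sqrt_one_add_norm_sq_le v w)
  set f := √(1 + ‖v‖ ^ 2)
  have hf_sq : f ^ 2 = 1 + ‖v‖ ^ 2 := Real.sq_sqrt (by positivity)
  have hf_one : 1 ≤ f := Real.one_le_sqrt.2 (by nlinarith [norm_nonneg v])
  have hinner : inner ℝ v w = f * (inner ℝ v w / f) := by field_simp
  set s := inner ℝ v w / f
  refine Real.sqrt_le_iff.2 ⟨by nlinarith [sq_nonneg (‖w‖ - 1)], ?_⟩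
  rw [norm_add_sq_real, hinner]
  nlinarith [sq_nonneg (s + ‖w‖ ^ 2 / 2), sq_nonneg ‖w‖]

lemma exp_sqrt_one_add_norm_add_sq_le (v : V) {w : V} (hw : ‖w‖ ≤ 1 / 2) :
    Real.exp √(1 + ‖v + w‖ ^ 2) ≤ Real.exp √(1 + ‖v‖ ^ 2) *
      (1 + inner ℝ v w / √(1 + ‖v‖ ^ 2) + 9 / 4 * ‖w‖ ^ 2) := by
  have hs := abs_inner_div_sqrt_one_add_norm_sq_le v w
  have hsqrt := sqrt_one_add_norm_add_sq_le v w
  set s := inner ℝ v w / √(1 + ‖v‖ ^ 2)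
  set y := s + ‖w‖ ^ 2 / 2 with hy_def
  have hy : |y| ≤ 5 / 4 * ‖w‖ := by
    refine (abs_add_le _ _).trans ?_
    rw [abs_of_nonneg (by positivity : 0 ≤ ‖w‖ ^ 2 / 2)]
    nlinarith [norm_nonneg w]
  have hy_sq : y ^ 2 ≤ (5 / 4 * ‖w‖) ^ 2 := sq_le_sq' (abs_le.1 hy).1 (abs_le.1 hy).2
  have hexp : Real.exp y - 1 - y ≤ y ^ 2 :=
    (abs_le.1 (Real.abs_exp_sub_one_sub_id_le (by linarith))).2
  refine (Real.exp_le_exp.2 hsqrt).trans ?_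
  rw [Real.exp_add]
  exact mul_le_mul_of_nonneg_left (by nlinarith [sq_nonneg ‖w‖])
    (Real.exp_pos _).le

lemma integral_exp_sqrt_one_add_norm_add_drop_smul_sq_le (hp₀ : 0 ≤ p) (hp₁ : p ≤ 3 / 4) (v : V)
    {w : V} (hw : ‖w‖ ≤ 1 / 6) :
    ∫ b, Real.exp √(1 + ‖v + drop p b • w‖ ^ 2) ∂bitLaw p ≤
      Real.exp (9 * p * ‖w‖ ^ 2) * Real.exp √(1 + ‖v‖ ^ 2) := by
  have := isProbabilityMeasure_bitLaw hp₀ (by linarith)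
  set f := √(1 + ‖v‖ ^ 2)
  set s := inner ℝ v w / f with hs
  have hpoint : ∀ b, Real.exp √(1 + ‖v + drop p b • w‖ ^ 2) ≤
      Real.exp f * (1 + drop p b * s + 9 / 4 * ‖w‖ ^ 2 * drop p b ^ 2) := fun b => by
    have hnorm : ‖drop p b • w‖ ≤ 1 / 2 := by
      rw [norm_smul, Real.norm_eq_abs]
      nlinarith [abs_drop_le hp₀ hp₁ b, norm_nonneg w, abs_nonneg (drop p b)]
    refine (exp_sqrt_one_add_norm_add_sq_le v hnorm).trans_eq ?_
    rw [inner_smul_right, norm_smul, mul_pow, Real.norm_eq_abs, sq_abs, mul_div_assoc, ← hs]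
    ring
  calc _ ≤ ∫ b, Real.exp f * (1 + drop p b * s + 9 / 4 * ‖w‖ ^ 2 * drop p b ^ 2) ∂bitLaw p :=
        integral_mono .of_finite .of_finite hpoint
    _ = Real.exp f * (1 + 9 / 4 * ‖w‖ ^ 2 * ∫ b, drop p b ^ 2 ∂bitLaw p) := by
        rw [integral_const_mul, integral_add .of_finite .of_finite,
          integral_add .of_finite .of_finite, integral_mul_const, integral_const_mul,
          integral_drop hp₀ (by linarith)]
        simp only [integral_const, probReal_univ, smul_eq_mul, zero_mul, mul_one, add_zero]
    _ ≤ Real.exp f * (9 * p * ‖w‖ ^ 2 + 1) :=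
        mul_le_mul_of_nonneg_left
          (by nlinarith [integral_drop_sq_le hp₀ hp₁, sq_nonneg ‖w‖]) (Real.exp_pos _).le
    _ ≤ Real.exp (9 * p * ‖w‖ ^ 2) * Real.exp f := by
        rw [mul_comm]
        exact mul_le_mul_of_nonneg_right (Real.add_one_le_exp _) (Real.exp_pos _).le

variable {ι κ : Type*} [Fintype ι] [DecidableEq ι] [LinearOrder κ] {rank : ι → κ}
  {u : ι → (ι → Bool) → V} {b : ι → ℝ}

-- The bits are revealed by increasing rank; `√(1 + ‖·‖²)` is a smooth substitute of the norm.
lemma integral_exp_sqrt_one_add_norm_sum_sq_le (hp₀ : 0 ≤ p) (hp₁ : p ≤ 3 / 4)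
    (hu : ∀ c c', rank c ≤ rank c' → ∀ ω x, u c (Function.update ω c' x) = u c ω)
    (hub : ∀ c ω, ‖u c ω‖ ≤ b c) (hb : ∀ c, b c ≤ 1 / 6) (T : Finset ι) :
    ∫ ω, Real.exp √(1 + ‖∑ c ∈ T, drop p (ω c) • u c ω‖ ^ 2) ∂(Measure.pi fun _ => bitLaw p) ≤
      Real.exp (1 + 9 * p * ∑ c ∈ T, b c ^ 2) := by
  have := isProbabilityMeasure_bitLaw hp₀ (by linarith)
  induction T using Finset.induction_on_max_value rank with
  | empty => simp
  | insert a T ha hmax ih =>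
    have hsplit : ∀ ω x, ∑ c ∈ insert a T, drop p (Function.update ω a x c) •
        u c (Function.update ω a x) = ∑ c ∈ T, drop p (ω c) • u c ω + drop p x • u a ω :=
      fun ω x => by
        rw [Finset.sum_insert ha, add_comm, Function.update_self, hu a a le_rfl]
        congr 1
        refine Finset.sum_congr rfl fun c hc => ?_
        rw [hu c a (hmax c hc), Function.update_of_ne (ne_of_mem_of_not_mem hc ha)]
    have hstep : ∀ ω, ∫ x, Real.exp √(1 + ‖∑ c ∈ T, drop p (ω c) • u c ω + drop p x • u a ω‖ ^ 2)
        ∂bitLaw p ≤ Real.exp (9 * p * b a ^ 2) *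
          Real.exp √(1 + ‖∑ c ∈ T, drop p (ω c) • u c ω‖ ^ 2) := fun ω => by
      refine (integral_exp_sqrt_one_add_norm_add_drop_smul_sq_le hp₀ hp₁ _
        ((hub a ω).trans (hb a))).trans ?_
      gcongr
      exact hub a ω
    rw [integral_pi_bitLaw_update hp₀ (by linarith) a]
    simp only [hsplit]
    calc _ ≤ _ := integral_mono .of_finite .of_finite hstep
      _ = Real.exp (9 * p * b a ^ 2) * _ := integral_const_mul _ _
      _ ≤ Real.exp (9 * p * b a ^ 2) * Real.exp (1 + 9 * p * ∑ c ∈ T, b c ^ 2) :=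
          mul_le_mul_of_nonneg_left ih (Real.exp_pos _).le
      _ = _ := by
          rw [← Real.exp_add, Finset.sum_insert ha]
          ring_nf

lemma measureReal_mul_le_norm_sum_drop_smul_le (hp₀ : 0 ≤ p) (hp₁ : p ≤ 3 / 4)
    (hu : ∀ c c', rank c ≤ rank c' → ∀ ω x, u c (Function.update ω c' x) = u c ω) {s : ℝ}
    (hs : 0 < s) (hub : ∀ c ω, ‖u c ω‖ ≤ s * b c) (hb : ∀ c, b c ≤ 1 / 6) (R : ℝ) :
    (Measure.pi fun _ => bitLaw p).real {ω | s * R ≤ ‖∑ c, drop p (ω c) • u c ω‖} ≤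
      Real.exp (1 + 9 * p * ∑ c, b c ^ 2 - R) := by
  have := isProbabilityMeasure_bitLaw hp₀ (by linarith)
  let g : (ι → Bool) → ℝ := fun ω => √(1 + ‖∑ c, drop p (ω c) • s⁻¹ • u c ω‖ ^ 2)
  have hmoment : ∫ ω, Real.exp (g ω) ∂(Measure.pi fun _ => bitLaw p) ≤
      Real.exp (1 + 9 * p * ∑ c, b c ^ 2) := by
    refine integral_exp_sqrt_one_add_norm_sum_sq_le hp₀ hp₁
      (fun c c' hc ω x => by rw [hu c c' hc]) (fun c ω => ?_) hb Finset.univ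
    rw [norm_smul, norm_inv, Real.norm_of_nonneg hs.le, inv_mul_le_iff₀ hs]
    exact hub c ω
  have hsub : {ω | s * R ≤ ‖∑ c, drop p (ω c) • u c ω‖} ⊆ {ω | Real.exp R ≤ Real.exp (g ω)} :=
    fun ω hω => by
      have hscale : ‖∑ c, drop p (ω c) • s⁻¹ • u c ω‖ = s⁻¹ * ‖∑ c, drop p (ω c) • u c ω‖ := by
        simp only [smul_comm _ s⁻¹, ← Finset.smul_sum, norm_smul, norm_inv,
          Real.norm_of_nonneg hs.le]
      refine Real.exp_le_exp.2
        (le_trans ?_ (Real.le_sqrt_of_sq_le (le_add_of_nonneg_left zero_le_one)))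
      rw [hscale, le_inv_mul_iff₀ hs]
      exact hω
  rw [Real.exp_sub, le_div_iff₀' (Real.exp_pos R)]
  exact (mul_le_mul_of_nonneg_left (measureReal_mono hsub) (Real.exp_pos _).le).trans <|
    (mul_meas_ge_le_integral_of_nonneg (.of_forall fun ω => (Real.exp_pos _).le) .of_finite
      (Real.exp R)).trans hmoment

end Concentration

section Forward

variable {d : ℕ} {h : ℕ → ℕ}

/-- The map `M^{i,j}` from the pre-activation vector of layer `i` to that of layer `j`, for
`i ≤ j`. Unlike `comp`, it is indexed by the target layer, so that the maps from different layers
to the same one have a common codomain. For `j < i` it carries no meaning. -/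
def fwd (θ : Params d h) (i : ℕ) : (j : ℕ) → E (h i) → E (h j)
  | 0 => fun v => if e : i = 0 then e ▸ v else 0
  | j + 1 => fun v => if e : i = j + 1 then e ▸ v else layer θ j (fwd θ i j v)

/-- The Jacobian `J^{i,j}` of `M^{i,j}` at the pre-activation vector of layer `i` on input `x`. -/
def fwdDeriv (θ : Params d h) (x : E (h 0)) (i j : ℕ) : E (h i) →L[ℝ] E (h j) :=
  fderiv ℝ (fwd θ i j) (pre θ x i)

variable (θ : Params d h) (x : E (h 0)) {i j : ℕ}

lemma fwd_self (i : ℕ) (v : E (h i)) : fwd θ i i v = v := by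
  cases i <;> simp [fwd]

lemma fwd_succ (hij : i ≤ j) (v : E (h i)) : fwd θ i (j + 1) v = layer θ j (fwd θ i j v) := by
  simp [fwd, show i ≠ j + 1 by omega]

lemma comp_eq_fwd (i n : ℕ) : comp θ i n = fwd θ i (i + n) := by
  induction n with
  | zero => exact (funext (fwd_self θ i)).symm
  | succ n ih =>
    funext v
    rw [comp, ih]
    exact (fwd_succ θ (Nat.le_add_right i n) v).symm

lemma fwd_layer (hij : i < j) (v : E (h i)) : fwd θ (i + 1) j (layer θ i v) = fwd θ i j v := by
  induction j, hij using Nat.le_induction with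
  | base => rw [fwd_self, fwd_succ θ le_rfl, fwd_self]
  | succ j hij ih => rw [fwd_succ θ hij, ih, fwd_succ θ (by omega)]

lemma fwd_pre (hij : i ≤ j) : fwd θ i j (pre θ x i) = pre θ x j := by
  induction j, hij using Nat.le_induction with
  | base => exact fwd_self θ i _
  | succ j hij ih =>
    rw [fwd_succ θ hij, ih]
    rfl

lemma fwd_smul (hij : i ≤ j) {a : ℝ} (ha : 0 ≤ a) (v : E (h i)) :
    fwd θ i j (a • v) = a • fwd θ i j v := by
  induction j, hij using Nat.le_induction with
  | base => rw [fwd_self, fwd_self]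
  | succ j hij ih => rw [fwd_succ θ hij, ih, fwd_succ θ hij, layer_smul θ ha]

lemma fderiv_apply_self_of_posHomogeneous {V W : Type*} [NormedAddCommGroup V] [NormedSpace ℝ V]
    [NormedAddCommGroup W] [NormedSpace ℝ W] {f : V → W} {v : V}
    (hf : ∀ a : ℝ, 0 ≤ a → f (a • v) = a • f v) (hv : DifferentiableAt ℝ f v) :
    fderiv ℝ f v v = f v := by
  have hray : HasDerivAt (fun t : ℝ => t • v) v 1 := by
    simpa using (hasDerivAt_id (1 : ℝ)).smul_const v
  have hchain : HasDerivAt (fun t : ℝ => f (t • v)) (fderiv ℝ f v v) 1 :=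
    HasFDerivAt.comp_hasDerivAt (1 : ℝ) (by simpa using hv.hasFDerivAt) hray
  have hhom : HasDerivAt (fun t : ℝ => f (t • v)) (f v) 1 := by
    have hlin : HasDerivAt (fun t : ℝ => t • f v) (f v) 1 := by
      simpa using (hasDerivAt_id (1 : ℝ)).smul_const (f v)
    refine hlin.congr_of_eventuallyEq ?_
    filter_upwards [lt_mem_nhds zero_lt_one] with t ht using hf t ht.le
  exact hchain.unique hhom

lemma jac_eq_fwdDeriv (i n : ℕ) : jac θ x i n = fwdDeriv θ x i (i + n) := by
  rw [jac, comp_eq_fwd, fwdDeriv]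

lemma fwdDeriv_self (i : ℕ) (v : E (h i)) : fwdDeriv θ x i i v = v := by
  rw [fwdDeriv, show fwd θ i i = id from funext (fwd_self θ i), fderiv_id]
  rfl

-- A nonzero value excludes the junk value of `fderiv` at a point of non-differentiability.
lemma fwdDeriv_pre (hij : i ≤ j) (hne : fwdDeriv θ x i j (pre θ x i) ≠ 0) :
    fwdDeriv θ x i j (pre θ x i) = pre θ x j := by
  have hdiff : DifferentiableAt ℝ (fwd θ i j) (pre θ x i) := by
    by_contra hdiff
    exact hne (by rw [fwdDeriv, fderiv_zero_of_not_differentiableAt hdiff]; rfl)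
  rw [fwdDeriv, fderiv_apply_self_of_posHomogeneous (fun a ha => fwd_smul θ hij ha _) hdiff,
    fwd_pre θ x hij]

end Forward

section Perturbation

variable {d : ℕ} {h : ℕ → ℕ} {θ θ' : Params d h} {x : E (h 0)}

-- Replacing the first `n` layers of `θ` by those of `θ'` one after the other telescopes.
lemma norm_fwd_pre_sub_sum_fwdDeriv_le {n j : ℕ} (hn : 1 ≤ n) (hnj : n ≤ j)
    (hone : pre θ' x 1 = pre θ x 1) {r : ℝ}
    (hlin : ∀ k ∈ Finset.Ico 1 n, ∀ v,
      (v = pre θ' x (k + 1) ∨ v = layer θ k (pre θ' x k)) →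
      ‖fwd θ (k + 1) j v - fwdDeriv θ x (k + 1) j v‖ ≤ r) :
    ‖fwd θ n j (pre θ' x n) - pre θ x j - ∑ k ∈ Finset.Ico 1 n,
      fwdDeriv θ x (k + 1) j (pre θ' x (k + 1) - layer θ k (pre θ' x k))‖ ≤ 2 * (n - 1) * r := by
  induction n, hn using Nat.le_induction with
  | base => simp [hone, fwd_pre θ x hnj]
  | succ n hn ih =>
    have hprev := ih (by omega) fun k hk =>
      hlin k (Finset.Ico_subset_Ico_right n.le_succ hk)
    have hmem : n ∈ Finset.Ico 1 (n + 1) := Finset.mem_Ico.2 ⟨hn, n.lt_succ_self⟩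
    have hy := hlin n hmem _ (Or.inl rfl)
    have hlayer := hlin n hmem _ (Or.inr rfl)
    rw [fwd_layer θ (by omega)] at hlayer
    rw [Finset.sum_Ico_succ_top hn, map_sub]
    set S := ∑ k ∈ Finset.Ico 1 n,
      fwdDeriv θ x (k + 1) j (pre θ' x (k + 1) - layer θ k (pre θ' x k))
    set a := fwd θ (n + 1) j (pre θ' x (n + 1))
    set a' := fwdDeriv θ x (n + 1) j (pre θ' x (n + 1))
    set b := fwd θ n j (pre θ' x n)
    set b' := fwdDeriv θ x (n + 1) j (layer θ n (pre θ' x n))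
    calc ‖a - pre θ x j - (S + (a' - b'))‖
        = ‖(b - pre θ x j - S) + (a - a') - (b - b')‖ := congrArg _ (by abel)
      _ ≤ ‖b - pre θ x j - S‖ + ‖a - a'‖ + ‖b - b'‖ :=
          (norm_sub_le _ _).trans (add_le_add_left (norm_add_le _ _) _)
      _ ≤ 2 * ((n + 1 : ℕ) - 1) * r := by
          push_cast
          linarith

lemma norm_layer_pre_sub_sum_fwdDeriv_le {Γ ρ : ℝ} {k : ℕ} (hΓ : 0 ≤ Γ) (hρ : 3 * (d : ℝ) ≤ ρ)
    (hk : 1 ≤ k) (hkd : k < d) (hone : pre θ' x 1 = pre θ x 1)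
    (hsmooth : ∀ i ∈ Finset.Ico 1 k, ∀ v, (v = pre θ' x (i + 1) ∨ v = layer θ i (pre θ' x i)) →
      ‖fwd θ (i + 1) (k + 1) v - fwdDeriv θ x (i + 1) (k + 1) v‖ ≤
        ‖v - pre θ x (i + 1)‖ * ‖pre θ x (k + 1)‖ / (ρ * ‖pre θ x (i + 1)‖))
    (hprev : ∀ i ∈ Finset.Ico 1 k, ∀ v, (v = pre θ' x (i + 1) ∨ v = layer θ i (pre θ' x i)) →
      ‖v - pre θ x (i + 1)‖ ≤ 3 * Γ * ‖pre θ x (i + 1)‖) :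
    ‖layer θ k (pre θ' x k) - pre θ x (k + 1) - ∑ i ∈ Finset.Ico 1 k,
      fwdDeriv θ x (i + 1) (k + 1) (pre θ' x (i + 1) - layer θ i (pre θ' x i))‖ ≤
      2 * Γ * ‖pre θ x (k + 1)‖ := by
  have hkd' : (k : ℝ) + 1 ≤ d := by exact_mod_cast hkd
  have hρ_pos : 0 < ρ := by linarith [(Nat.cast_nonneg k : (0 : ℝ) ≤ k)]
  have hlin : ∀ i ∈ Finset.Ico 1 k, ∀ v, (v = pre θ' x (i + 1) ∨ v = layer θ i (pre θ' x i)) →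
      ‖fwd θ (i + 1) (k + 1) v - fwdDeriv θ x (i + 1) (k + 1) v‖ ≤
        3 * Γ / ρ * ‖pre θ x (k + 1)‖ := fun i hi v hv => by
    refine (hsmooth i hi v hv).trans (div_le_of_le_mul₀ (by positivity) (by positivity) ?_)
    refine (mul_le_mul_of_nonneg_right (hprev i hi v hv) (norm_nonneg _)).trans_eq ?_
    field_simp
  have htelescope := norm_fwd_pre_sub_sum_fwdDeriv_le hk k.le_succ hone hlin
  rw [fwd_succ θ le_rfl, fwd_self] at htelescope
  have hratio : ((k : ℝ) - 1) * 3 / ρ ≤ 1 := by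
    rw [div_le_one hρ_pos]
    linarith
  refine htelescope.trans ?_
  calc _ = 2 * (((k : ℝ) - 1) * 3 / ρ) * (Γ * ‖pre θ x (k + 1)‖) := by ring
    _ ≤ 2 * 1 * (Γ * ‖pre θ x (k + 1)‖) := by gcongr
    _ = _ := by ring

lemma norm_pre_sub_le_of_sum_fwdDeriv_le {Γ ρ : ℝ} (hΓ : 0 ≤ Γ)
    (hρ : 3 * (d : ℝ) ≤ ρ) (hone : pre θ' x 1 = pre θ x 1)
    (hsmooth : ∀ k j, 1 ≤ k → k + 1 ≤ j → j ≤ d →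
      ∀ v, (v = pre θ' x (k + 1) ∨ v = layer θ k (pre θ' x k)) →
      ‖fwd θ (k + 1) j v - fwdDeriv θ x (k + 1) j v‖ ≤
        ‖v - pre θ x (k + 1)‖ * ‖pre θ x j‖ / (ρ * ‖pre θ x (k + 1)‖))
    {ξ : ∀ k, E (h (k + 1))}
    (hξ : ∀ k, 1 ≤ k → k < d → ‖pre θ' x k - pre θ x k‖ ≤ 3 * Γ * ‖pre θ x k‖ →
      pre θ' x (k + 1) - layer θ k (pre θ' x k) = ξ k)
    (hsum : ∀ n j, n ≤ j → j ≤ d →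
      ‖∑ k ∈ Finset.Ico 1 n, fwdDeriv θ x (k + 1) j (ξ k)‖ ≤ Γ * ‖pre θ x j‖)
    {j : ℕ} (hj : 1 ≤ j) (hjd : j ≤ d) : ‖pre θ' x j - pre θ x j‖ ≤ 3 * Γ * ‖pre θ x j‖ := by
  suffices H : ∀ k < d, ∀ v, (v = pre θ' x (k + 1) ∨ v = layer θ k (pre θ' x k)) →
      ‖v - pre θ x (k + 1)‖ ≤ 3 * Γ * ‖pre θ x (k + 1)‖ by
    obtain ⟨k, rfl⟩ := Nat.exists_eq_add_of_le' hj
    exact H k hjd _ (Or.inl rfl)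
  intro k
  induction k using Nat.strong_induction_on with
  | _ k ih =>
  intro hkd v hv
  rcases k.eq_zero_or_pos with rfl | hk
  · obtain rfl : v = pre θ x 1 := hv.elim (·.trans hone) id
    simpa using by positivity
  have hdefect : ∀ i ∈ Finset.Ico 1 (k + 1), pre θ' x (i + 1) - layer θ i (pre θ' x i) = ξ i := by
    intro i hi
    obtain ⟨i, rfl⟩ := Nat.exists_eq_add_of_le' (Finset.mem_Ico.1 hi).1
    have hik := (Finset.mem_Ico.1 hi).2
    exact hξ _ (by omega) (by omega) (ih i (by omega) (by omega) _ (Or.inl rfl))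
  have hlayer := norm_layer_pre_sub_sum_fwdDeriv_le hΓ hρ hk hkd hone
    (fun i hi => hsmooth i (k + 1) (Finset.mem_Ico.1 hi).1 (by have := Finset.mem_Ico.1 hi; omega)
      hkd)
    (fun i hi => ih i (Finset.mem_Ico.1 hi).2 ((Finset.mem_Ico.1 hi).2.trans hkd))
  rw [Finset.sum_congr rfl fun i hi => by
    rw [hdefect i (Finset.Ico_subset_Ico_right k.le_succ hi)]] at hlayer
  set S := ∑ i ∈ Finset.Ico 1 k, fwdDeriv θ x (i + 1) (k + 1) (ξ i) with hS
  have hclose : ∀ T, ‖T‖ ≤ Γ * ‖pre θ x (k + 1)‖ → v = layer θ k (pre θ' x k) - S + T →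
      ‖v - pre θ x (k + 1)‖ ≤ 3 * Γ * ‖pre θ x (k + 1)‖ := fun T hT hvT => by
    calc ‖v - pre θ x (k + 1)‖ = ‖(layer θ k (pre θ' x k) - pre θ x (k + 1) - S) + T‖ :=
          congrArg _ (by rw [hvT]; abel)
      _ ≤ _ := (norm_add_le _ _).trans (by linarith)
  rcases hv with rfl | rfl
  · refine hclose _ (hsum (k + 1) (k + 1) le_rfl hkd) ?_
    rw [Finset.sum_Ico_succ_top hk, fwdDeriv_self, ← hS,
      ← hdefect k (Finset.mem_Ico.2 ⟨hk, k.lt_succ_self⟩)]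
    abel
  · exact hclose _ (hsum k (k + 1) k.le_succ hkd) (sub_add_cancel _ S).symm

end Perturbation

section Dropout

variable {d : ℕ} {h : ℕ → ℕ}

/-- The point with parameter `t` of the segment from the dropped-out network to the network. -/
def mix (p : ℝ) (θ : Params d h) (ω : Mask d h) (t : ℝ) : Params d h :=
  t • θ + (1 - t) • dropUpTo p θ ω d

/-- The size `(1 - t) φ(x^k)_c` of the change that dropout of column `c` of the matrix of layer
`k + 1` causes, with activations cut off at `T k`. -/
def cutoff (p : ℝ) (θ : Params d h) (ω : Mask d h) (x : E (h 0)) (t : ℝ) (T : ℕ → ℝ) (k : ℕ)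
    (c : Fin (h k)) : ℝ :=
  (1 - t) * min (relu (pre (mix p θ ω t) x k) c) (T k)

/-- The change that dropout in the matrix of layer `k + 1` causes in the pre-activation vector of
this layer, with activations cut off at `T k`. The cutoff makes it bounded for all outcomes of
dropout, as the concentration inequality requires. -/
def noise (p : ℝ) (θ : Params d h) (ω : Mask d h) (x : E (h 0)) (t : ℝ) (T : ℕ → ℝ) (k : ℕ) :
    E (h (k + 1)) :=
  if hk : k < d then
    mulE (θ ⟨k, hk⟩) (WithLp.toLp 2 fun c => drop p (ω ⟨⟨k, hk⟩, c⟩) * cutoff p θ ω x t T k c)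
  else 0

/-- The change of the pre-activation vector of layer `j` that dropout in the layers `2, …, n`
causes to first order. -/
def noiseSum (p : ℝ) (θ : Params d h) (ω : Mask d h) (x : E (h 0)) (t : ℝ) (T : ℕ → ℝ)
    (n j : ℕ) : E (h j) :=
  ∑ k ∈ Finset.Ico 1 n, fwdDeriv θ x (k + 1) j (noise p θ ω x t T k)

variable {p t : ℝ} {θ : Params d h} {ω : Mask d h} {x : E (h 0)} {T : ℕ → ℝ}

lemma mix_zero (hd : 0 < d) : mix p θ ω t ⟨0, hd⟩ = θ ⟨0, hd⟩ := by
  simp only [mix, Pi.add_apply, Pi.smul_apply, dropUpTo]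
  rw [if_neg (by simp), ← add_smul, add_sub_cancel, one_smul]

lemma mix_apply {k : Fin d} (hk : 1 ≤ (k : ℕ)) (r : Fin (h (k + 1))) (c : Fin (h k)) :
    mix p θ ω t k r c = (1 + (1 - t) * drop p (ω ⟨k, c⟩)) * θ k r c := by
  have hkd : 2 ≤ (k : ℕ) + 1 ∧ (k : ℕ) + 1 ≤ d := ⟨by omega, k.2⟩
  simp only [mix, Pi.add_apply, Pi.smul_apply, dropUpTo, hkd, and_self, if_true,
    Matrix.add_apply, Matrix.smul_apply, dropLayer, Matrix.of_apply, smul_eq_mul, drop]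
  ring

lemma hatX_self {i : ℕ} : hatX p θ ω x i i t = pre (mix p θ ω t) x i :=
  pre_congr x fun k hk => by
    simp only [mix, Pi.add_apply, Pi.smul_apply, dropUpTo, Nat.succ_le_of_lt hk,
      Nat.succ_le_of_lt k.2]

lemma hatX_pred {k : ℕ} (hk : k < d) :
    hatX p θ ω x (k + 1) k t = layer θ k (pre (mix p θ ω t) x k) := by
  have hlast : (t • θ + (1 - t) • dropUpTo p θ ω k) ⟨k, hk⟩ = θ ⟨k, hk⟩ := by
    simp only [Pi.add_apply, Pi.smul_apply, dropUpTo]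
    rw [if_neg (by simp), ← add_smul, add_sub_cancel, one_smul]
  rw [hatX, pre_succ _ x hk, layer_of_lt θ hk, hlast]
  exact congrArg (fun v => mulE (θ ⟨k, hk⟩) (act k v)) hatX_self

lemma pre_mix_update {k : ℕ} {c : (k : Fin d) × Fin (h k)} (hk : k ≤ c.1) (b : Bool) :
    pre (mix p θ (Function.update ω c b) t) x k = pre (mix p θ ω t) x k := by
  refine pre_congr x fun i hi => ?_
  rcases Nat.eq_zero_or_pos i with hi₀ | hi₀
  · have hi_zero : i = ⟨0, i.pos⟩ := Fin.ext hi₀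
    rw [hi_zero, mix_zero, mix_zero]
  · ext r j
    rw [mix_apply hi₀, mix_apply hi₀, Function.update_of_ne]
    rintro rfl
    exact absurd hk (not_le.2 hi)

lemma abs_cutoff_le (ht : t ∈ Icc (0 : ℝ) 1) {k : ℕ} (hT : 0 ≤ T k) (c : Fin (h k)) :
    |cutoff p θ ω x t T k c| ≤ T k := by
  have hmin : 0 ≤ min (relu (pre (mix p θ ω t) x k) c) (T k) := le_min (le_max_right _ _) hT
  rw [cutoff, abs_of_nonneg (mul_nonneg (sub_nonneg.2 ht.2) hmin)]
  exact (mul_le_of_le_one_left hmin (by linarith [ht.1])).trans (min_le_right _ _)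

lemma pre_mix_succ_sub_layer {k : ℕ} (hk₁ : 1 ≤ k) (hk : k < d)
    (hT : ∀ c, relu (pre (mix p θ ω t) x k) c ≤ T k) :
    pre (mix p θ ω t) x (k + 1) - layer θ k (pre (mix p θ ω t) x k) = noise p θ ω x t T k := by
  rw [pre_succ _ x hk, layer_of_lt θ hk, noise, dif_pos hk, act_of_pos hk₁]
  ext r
  simp only [PiLp.sub_apply, mulE_apply, ← Finset.sum_sub_distrib]
  refine Finset.sum_congr rfl fun c _ => ?_
  rw [mix_apply hk₁, cutoff, min_eq_left (hT c)]
  ring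

lemma sum_Ico_one_eq_sum_fin {V : Type*} [AddCommMonoid V] {n : ℕ} (hn : n ≤ d) (F : ℕ → V) :
    ∑ k ∈ Finset.Ico 1 n, F k = ∑ k : Fin d, if (k : ℕ) ∈ Finset.Ico 1 n then F k else 0 := by
  rw [← Finset.sum_range fun k => if k ∈ Finset.Ico 1 n then F k else 0, Finset.sum_ite_mem,
    Finset.inter_eq_right.2]
  exact fun k hk => Finset.mem_range.2 ((Finset.mem_Ico.1 hk).2.trans_le hn)

lemma fwdDeriv_noise (k : Fin d) (j : ℕ) :
    fwdDeriv θ x (k + 1) j (noise p θ ω x t T k) = ∑ c, drop p (ω ⟨k, c⟩) •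
      cutoff p θ ω x t T k c • fwdDeriv θ x (k + 1) j (mulE (θ k) (EuclideanSpace.single c 1)) := by
  rw [noise, dif_pos k.2, mulE_eq_sum_single, map_sum]
  exact Finset.sum_congr rfl fun c _ => by rw [map_smul, smul_smul]

lemma sum_sq_colNorm_div_frob_le_one {n m : ℕ} (A : Matrix (Fin m) (Fin n) ℝ) :
    ∑ c, (colNorm A c / frob A) ^ 2 ≤ 1 := by
  simp only [div_pow, ← Finset.sum_div, ← frob_sq]
  exact div_self_le_one _

lemma norm_cutoff_smul_fwdDeriv_le {C : ℝ} {j : ℕ} (ht : t ∈ Icc (0 : ℝ) 1) (k : Fin d)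
    (hT : 0 ≤ T k) (hfrob : 0 < frob (θ k))
    (hC : T k * ‖fwdDeriv θ x (k + 1) j‖ * frob (θ k) ≤ C) (c : Fin (h k)) :
    ‖cutoff p θ ω x t T k c •
      fwdDeriv θ x (k + 1) j (mulE (θ k) (EuclideanSpace.single c 1))‖ ≤
      C * (colNorm (θ k) c / frob (θ k)) := by
  have hcolumn := (fwdDeriv θ x (k + 1) j).le_opNorm (mulE (θ k) (EuclideanSpace.single c 1))
  rw [norm_mulE_single] at hcolumn
  rw [norm_smul, Real.norm_eq_abs]
  calc _ ≤ T k * (‖fwdDeriv θ x (k + 1) j‖ * colNorm (θ k) c) :=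
        mul_le_mul (abs_cutoff_le ht hT c) hcolumn (norm_nonneg _) hT
    _ = T k * ‖fwdDeriv θ x (k + 1) j‖ * frob (θ k) * (colNorm (θ k) c / frob (θ k)) := by
        field_simp
    _ ≤ _ := mul_le_mul_of_nonneg_right hC (div_nonneg (colNorm_nonneg _ _) hfrob.le)

/-- The share of column `c` of the matrix of layer `k + 1` in the Frobenius norm of this matrix,
scaled so that the concentration inequality applies; only layers `2, …, n` count. -/
def colShare (θ : Params d h) (a : ℝ) (n : ℕ) (c : (k : Fin d) × Fin (h k)) : ℝ :=
  if (c.1 : ℕ) ∈ Finset.Ico 1 n then a⁻¹ * (colNorm (θ c.1) c.2 / frob (θ c.1)) else 0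

lemma colShare_le_one_div_six {K : ℝ} (hK : 0 ≤ K) (hp : 0 < p)
    (hcol : ∀ k : Fin d, 1 ≤ (k : ℕ) → ∀ c, colNorm (θ k) c ≤ K * √p * frob (θ k))
    (hfrob : ∀ k : Fin d, 1 ≤ (k : ℕ) → 0 < frob (θ k)) (n : ℕ) (c : (k : Fin d) × Fin (h k)) :
    colShare θ (6 * (K + 1) * √p) n c ≤ 1 / 6 := by
  have hp_sqrt : 0 < √p := Real.sqrt_pos.2 hp
  rw [colShare]
  split_ifs with hc
  · have hc₁ := (Finset.mem_Ico.1 hc).1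
    have hratio := (div_le_iff₀ (hfrob c.1 hc₁)).2 (hcol c.1 hc₁ c.2)
    rw [inv_mul_le_iff₀ (by positivity)]
    linarith
  · norm_num

lemma sum_sq_colShare_le (θ : Params d h) (a : ℝ) (n : ℕ) :
    ∑ c, colShare θ a n c ^ 2 ≤ d * (a ^ 2)⁻¹ := by
  have hlayer : ∀ k : Fin d, ∑ c, colShare θ a n ⟨k, c⟩ ^ 2 ≤ (a ^ 2)⁻¹ := fun k => by
    simp only [colShare]
    split_ifs
    · simp only [mul_pow, ← Finset.mul_sum, inv_pow]
      exact mul_le_of_le_one_right (by positivity) (sum_sq_colNorm_div_frob_le_one _)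
    · simpa using sq_nonneg a
  rw [Fintype.sum_sigma]
  exact (Finset.sum_le_sum fun k _ => hlayer k).trans_eq (by simp)

lemma measureReal_mul_le_norm_noiseSum_le {K s R : ℝ} {n j : ℕ} (hp₀ : 0 < p)
    (hp₁ : p ≤ 3 / 4) (hK : 0 ≤ K) (ht : t ∈ Icc (0 : ℝ) 1) (hn : n ≤ d) (hs : 0 < s)
    (hT : ∀ k, 0 ≤ T k)
    (hcol : ∀ k : Fin d, 1 ≤ (k : ℕ) → ∀ c, colNorm (θ k) c ≤ K * √p * frob (θ k))
    (hfrob : ∀ k : Fin d, 1 ≤ (k : ℕ) → 0 < frob (θ k))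
    (hderiv : ∀ k : Fin d, 1 ≤ (k : ℕ) → (k : ℕ) < n →
      T k * ‖fwdDeriv θ x (k + 1) j‖ * frob (θ k) ≤ s * (6 * (K + 1) * √p)⁻¹) :
    (maskLaw d h p).real {ω | s * R ≤ ‖noiseSum p θ ω x t T n j‖} ≤
      Real.exp (1 + d / 4 - R) := by
  let u : ((k : Fin d) × Fin (h k)) → Mask d h → E (h j) := fun c ω =>
    if (c.1 : ℕ) ∈ Finset.Ico 1 n then cutoff p θ ω x t T c.1 c.2 •
      fwdDeriv θ x (c.1 + 1) j (mulE (θ c.1) (EuclideanSpace.single c.2 1)) else 0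
  have hu : ∀ c c', (c.1 : ℕ) ≤ (c'.1 : ℕ) → ∀ ω y, u c (Function.update ω c' y) = u c ω :=
    fun c c' hcc ω y => by simp only [u, cutoff, pre_mix_update hcc y]
  have hsum : ∀ ω, noiseSum p θ ω x t T n j = ∑ c, drop p (ω c) • u c ω := fun ω => by
    rw [noiseSum, sum_Ico_one_eq_sum_fin hn, Fintype.sum_sigma]
    refine Finset.sum_congr rfl fun k _ => ?_
    simp only [u]
    split_ifs
    · exact fwdDeriv_noise k j
    · simp
  have hub : ∀ c ω, ‖u c ω‖ ≤ s * colShare θ (6 * (K + 1) * √p) n c := by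
    rintro ⟨k, c⟩ ω
    simp only [u, colShare]
    split_ifs with hk
    · obtain ⟨hk₁, hkn⟩ := Finset.mem_Ico.1 hk
      exact (norm_cutoff_smul_fwdDeriv_le ht k (hT k) (hfrob k hk₁) (hderiv k hk₁ hkn) c).trans_eq
        (mul_assoc _ _ _)
    · simp
  have hvariance : 9 * p * ∑ c, colShare θ (6 * (K + 1) * √p) n c ^ 2 ≤ d / 4 := by
    refine (mul_le_mul_of_nonneg_left (sum_sq_colShare_le θ _ n) (by positivity)).trans ?_
    rw [mul_pow, Real.sq_sqrt hp₀.le, ← mul_assoc, ← div_eq_mul_inv,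
      div_le_iff₀ (by positivity)]
    nlinarith [mul_nonneg (mul_nonneg (Nat.cast_nonneg (α := ℝ) d) hp₀.le)
      (by positivity : 0 ≤ K ^ 2 + 2 * K)]
  simp only [hsum]
  exact (measureReal_mul_le_norm_sum_drop_smul_le hp₀.le hp₁ hu hs hub
    (colShare_le_one_div_six hK hp₀ hcol hfrob n) R).trans (Real.exp_le_exp.2 (by linarith))

end Dropout

section Cushions

variable {d m : ℕ} {h : ℕ → ℕ} {θ : Params d h} {X : Fin m → E (h 0)} {k : Fin d} {i j : ℕ}

lemma minWidth_le (hi : 1 ≤ i) (hid : i < d) : minWidth d h ≤ h i := by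
  obtain ⟨i, rfl⟩ := Nat.exists_eq_add_of_le' hi
  exact ciInf_le (f := fun k : Fin (d - 1) => h (k + 1)) (OrderBot.bddBelow _) ⟨i, by omega⟩

lemma norm_pre_le_actContraction (s : Fin m) (hi : 1 ≤ i) (hid : i < d)
    (hne : relu (pre θ (X s) i) ≠ 0) :
    ‖pre θ (X s) i‖ ≤ actContraction θ X * ‖relu (pre θ (X s) i)‖ := by
  obtain ⟨i, rfl⟩ := Nat.exists_eq_add_of_le' hi
  refine (div_le_iff₀ (norm_pos_iff.2 hne)).1 ?_
  exact le_ciSup (f := fun z : Fin m × Fin (d - 1) =>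
    ‖pre θ (X z.1) (z.2 + 1)‖ / ‖relu (pre θ (X z.1) (z.2 + 1))‖) (Set.finite_range _).bddAbove
    (s, ⟨i, by omega⟩)

lemma minCushion_le (hk : 1 ≤ (k : ℕ)) :
    minCushion θ X ≤ layerCushion θ X k * minInterlayerCushion θ X (k + 1) := by
  obtain ⟨k, hkd⟩ := k
  obtain ⟨k, rfl⟩ := Nat.exists_eq_add_of_le' hk
  exact ciInf_le (Set.finite_range _).bddBelow (⟨k, by omega⟩ : Fin (d - 1))

lemma layerCushion_nonneg (k : Fin d) : 0 ≤ layerCushion θ X k :=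
  Real.iInf_nonneg fun _ => div_nonneg (norm_nonneg _)
    (mul_nonneg (Real.sqrt_nonneg _) (norm_nonneg _))

lemma minInterlayerCushion_nonneg (i : ℕ) : 0 ≤ minInterlayerCushion θ X i :=
  Real.iInf_nonneg fun _ => Real.iInf_nonneg fun _ => by positivity

lemma layerCushion_pos (hμ : 0 < minCushion θ X) (hk : 1 ≤ (k : ℕ)) : 0 < layerCushion θ X k :=
  pos_of_mul_pos_left (hμ.trans_le (minCushion_le hk)) (minInterlayerCushion_nonneg _)

lemma minInterlayerCushion_pos (hμ : 0 < minCushion θ X) (hk : 1 ≤ (k : ℕ)) :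
    0 < minInterlayerCushion θ X (k + 1) :=
  pos_of_mul_pos_right (hμ.trans_le (minCushion_le hk)) (layerCushion_nonneg _)

lemma layerCushion_le (s : Fin m) (hk : 1 ≤ (k : ℕ)) :
    layerCushion θ X k ≤
      ‖pre θ (X s) (k + 1)‖ / (frob (θ k) * ‖relu (pre θ (X s) k)‖) := by
  rw [pre_succ θ (X s) k.2, act_of_pos hk]
  exact ciInf_le (Set.finite_range _).bddBelow s

lemma minInterlayerCushion_le (s : Fin m) (hij : i ≤ j) (hjd : j ≤ d) :
    minInterlayerCushion θ X i ≤ ‖fwdDeriv θ (X s) i j (pre θ (X s) i)‖ /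
      (‖fwdDeriv θ (X s) i j‖ * ‖pre θ (X s) i‖) := by
  obtain ⟨n, rfl⟩ := Nat.exists_eq_add_of_le hij
  rw [← jac_eq_fwdDeriv]
  calc _ ≤ interlayerCushion θ X i n :=
        ciInf_le (f := fun n : Fin (d - i + 1) => interlayerCushion θ X i n)
          (Set.finite_range _).bddBelow ⟨n, by omega⟩
    _ ≤ _ := ciInf_le (Set.finite_range _).bddBelow s

lemma frob_pos (hμ : 0 < minCushion θ X) (s : Fin m) (hk : 1 ≤ (k : ℕ)) : 0 < frob (θ k) := by
  have hpos := (layerCushion_pos hμ hk).trans_le (layerCushion_le s hk)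
  refine (Real.sqrt_nonneg _).lt_of_ne' fun hzero => ?_
  simp [frob, hzero] at hpos

lemma relu_pre_ne_zero (hμ : 0 < minCushion θ X) (s : Fin m) (hi : 1 ≤ i) (hid : i < d) :
    relu (pre θ (X s) i) ≠ 0 := fun hzero => by
  have hpos := (layerCushion_pos hμ hi).trans_le (layerCushion_le (k := ⟨i, hid⟩) s hi)
  simp [hzero] at hpos

lemma pre_ne_zero (hμ : 0 < minCushion θ X) (s : Fin m) (hd : 2 ≤ d) (hj : 1 ≤ j) (hjd : j ≤ d) :
    pre θ (X s) j ≠ 0 := fun hzero => by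
  obtain ⟨k, rfl⟩ := Nat.exists_eq_add_of_le' hj
  rcases k.eq_zero_or_pos with rfl | hk
  · refine relu_pre_ne_zero hμ s le_rfl hd (norm_le_zero_iff.1 ((norm_relu_le _).trans ?_))
    rw [hzero, norm_zero]
  · have hpos := (layerCushion_pos (k := ⟨k, hjd⟩) hμ hk).trans_le (layerCushion_le s hk)
    simp [hzero] at hpos

lemma norm_fwdDeriv_mul_le (hμ : 0 < minCushion θ X) (s : Fin m) (hk : 1 ≤ (k : ℕ))
    (hkj : (k : ℕ) + 1 ≤ j) (hjd : j ≤ d) :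
    ‖fwdDeriv θ (X s) (k + 1) j‖ * frob (θ k) * ‖relu (pre θ (X s) k)‖ * minCushion θ X ≤
      ‖pre θ (X s) j‖ := by
  have hlayer : layerCushion θ X k * (frob (θ k) * ‖relu (pre θ (X s) k)‖) ≤
      ‖pre θ (X s) (k + 1)‖ :=
    mul_le_of_le_div₀ (norm_nonneg _) (mul_nonneg (Real.sqrt_nonneg _) (norm_nonneg _))
      (layerCushion_le s hk)
  have hinter := minInterlayerCushion_le (θ := θ) (X := X) s hkj hjd
  have hne : fwdDeriv θ (X s) (k + 1) j (pre θ (X s) (k + 1)) ≠ 0 := fun hzero => by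
    have hpos := (minInterlayerCushion_pos hμ hk).trans_le hinter
    simp [hzero] at hpos
  rw [fwdDeriv_pre θ (X s) hkj hne] at hinter
  have hfrob : 0 ≤ frob (θ k) := Real.sqrt_nonneg _
  calc _ ≤ ‖fwdDeriv θ (X s) (k + 1) j‖ * frob (θ k) * ‖relu (pre θ (X s) k)‖ *
          (layerCushion θ X k * minInterlayerCushion θ X (k + 1)) := by
        gcongr
        exact minCushion_le hk
    _ = minInterlayerCushion θ X (k + 1) * (‖fwdDeriv θ (X s) (k + 1) j‖ *
          (layerCushion θ X k * (frob (θ k) * ‖relu (pre θ (X s) k)‖))) := by ring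
    _ ≤ minInterlayerCushion θ X (k + 1) *
          (‖fwdDeriv θ (X s) (k + 1) j‖ * ‖pre θ (X s) (k + 1)‖) := by
        gcongr
        exact minInterlayerCushion_nonneg _
    _ ≤ _ := mul_le_of_le_div₀ (norm_nonneg _) (by positivity) hinter

lemma actContraction_pos (hμ : 0 < minCushion θ X) (s : Fin m) (hd : 2 ≤ d) :
    0 < actContraction θ X := by
  have hrelu := relu_pre_ne_zero hμ s le_rfl hd
  refine pos_of_mul_pos_left (lt_of_lt_of_le ?_ (norm_pre_le_actContraction s le_rfl hd hrelu))
    (norm_nonneg _)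
  exact norm_pos_iff.2 (pre_ne_zero hμ s hd le_rfl (by omega))

end Cushions

section Lipschitz

variable {d : ℕ} {h : ℕ → ℕ} {p a t t' : ℝ} {θ : Params d h} {ω : Mask d h}

lemma mix_apply_eq_mul (k : Fin d) (r : Fin (h (k + 1))) (c : Fin (h k)) :
    mix p θ ω t k r c =
      (1 + (1 - t) * if 1 ≤ (k : ℕ) then drop p (ω ⟨k, c⟩) else 0) * θ k r c := by
  split_ifs with hk
  · exact mix_apply hk r c
  · have hk_zero : k = ⟨0, k.pos⟩ := Fin.ext (by omega : (k : ℕ) = 0)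
    rw [mul_zero, add_zero, one_mul, show mix p θ ω t k = θ k from hk_zero ▸ mix_zero k.pos]

lemma abs_ite_drop_le (hp₀ : 0 ≤ p) (hp₁ : p ≤ 3 / 4) (k : Fin d) (c : Fin (h k)) :
    |if 1 ≤ (k : ℕ) then drop p (ω ⟨k, c⟩) else 0| ≤ 3 := by
  split_ifs
  · exact abs_drop_le hp₀ hp₁ _
  · norm_num

lemma norm_mulE_mix_le (hp₀ : 0 ≤ p) (hp₁ : p ≤ 3 / 4) (ht : t ∈ Icc (0 : ℝ) 1) (k : Fin d)
    (v : E (h k)) : ‖mulE (mix p θ ω t k) v‖ ≤ opNorm (θ k) * (4 * ‖v‖) := by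
  refine norm_mulE_le_of_scaled_columns (by norm_num) (fun c => ?_) (mix_apply_eq_mul k) v
  have hdrop := abs_le.1 (abs_ite_drop_le (ω := ω) hp₀ hp₁ k c)
  rw [abs_le]
  constructor <;> nlinarith [ht.1, ht.2]

lemma norm_mulE_mix_sub_le (hp₀ : 0 ≤ p) (hp₁ : p ≤ 3 / 4) (k : Fin d) (v : E (h k)) :
    ‖mulE (mix p θ ω t k - mix p θ ω t' k) v‖ ≤ opNorm (θ k) * (4 * |t - t'| * ‖v‖) := by
  refine norm_mulE_le_of_scaled_columns
    (e := fun c => (t' - t) * if 1 ≤ (k : ℕ) then drop p (ω ⟨k, c⟩) else 0)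
    (by positivity) (fun c => ?_) (fun r c => ?_) v
  · rw [abs_mul, abs_sub_comm t' t, mul_comm]
    exact mul_le_mul_of_nonneg_right ((abs_ite_drop_le hp₀ hp₁ k c).trans (by norm_num))
      (abs_nonneg _)
  · rw [Matrix.sub_apply, mix_apply_eq_mul, mix_apply_eq_mul]
    ring

lemma norm_pre_mix_le (x : E (h 0)) (hp₀ : 0 ≤ p) (hp₁ : p ≤ 3 / 4) (ht : t ∈ Icc (0 : ℝ) 1)
    (ha : ∀ k, opNorm (θ k) ≤ a) {k : ℕ} (hk : k ≤ d) :
    ‖pre (mix p θ ω t) x k‖ ≤ (4 * a) ^ k * ‖x‖ := by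
  induction k with
  | zero => simp [pre]
  | succ k ih =>
    have ha₀ : 0 ≤ a := (opNorm_nonneg _).trans (ha ⟨k, hk⟩)
    rw [pre_succ _ x hk]
    calc _ ≤ a * (4 * ((4 * a) ^ k * ‖x‖)) := by
          refine (norm_mulE_mix_le hp₀ hp₁ ht ⟨k, hk⟩ _).trans ?_
          gcongr
          · exact ha _
          · exact (norm_act_le _).trans (ih (by omega))
      _ = _ := by ring

lemma norm_pre_mix_sub_le (x : E (h 0)) (hp₀ : 0 ≤ p) (hp₁ : p ≤ 3 / 4) (ht : t ∈ Icc (0 : ℝ) 1)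
    (ht' : t' ∈ Icc (0 : ℝ) 1) (ha : ∀ k, opNorm (θ k) ≤ a) {k : ℕ} (hk : k ≤ d) :
    ‖pre (mix p θ ω t) x k - pre (mix p θ ω t') x k‖ ≤
      k * (4 * a) ^ k * |t - t'| * ‖x‖ := by
  induction k with
  | zero => simp [pre]
  | succ k ih =>
    have ha₀ : 0 ≤ a := (opNorm_nonneg _).trans (ha ⟨k, hk⟩)
    rw [pre_succ _ x hk, pre_succ _ x hk]
    set A := mix p θ ω t ⟨k, hk⟩
    set A' := mix p θ ω t' ⟨k, hk⟩
    set v := act k (pre (mix p θ ω t) x k)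
    set v' := act k (pre (mix p θ ω t') x k)
    have hsplit : mulE A v - mulE A' v' = mulE A (v - v') + mulE (A - A') v' := by
      simp [mulE, Matrix.mulVec_sub, Matrix.sub_mulVec]
    have hvector : ‖mulE A (v - v')‖ ≤ a * (4 * (k * (4 * a) ^ k * |t - t'| * ‖x‖)) := by
      refine (norm_mulE_mix_le hp₀ hp₁ ht ⟨k, hk⟩ _).trans ?_
      gcongr
      · exact ha _
      · exact (norm_act_sub_le _ _).trans (ih (by omega))
    have hmatrix : ‖mulE (A - A') v'‖ ≤ a * (4 * |t - t'| * ((4 * a) ^ k * ‖x‖)) := by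
      refine (norm_mulE_mix_sub_le hp₀ hp₁ ⟨k, hk⟩ _).trans ?_
      gcongr
      · exact ha _
      · exact (norm_act_le _).trans (norm_pre_mix_le x hp₀ hp₁ ht' ha (by omega))
    rw [hsplit]
    refine (norm_add_le _ _).trans ((add_le_add hvector hmatrix).trans_eq ?_)
    push_cast
    ring

end Lipschitz

section GoodMask

variable {d m : ℕ} {h hstar : ℕ → ℕ} {p K K₂ t : ℝ} {θ : Params d h} {X : Fin m → E (h 0)}
  {ω : Mask d h} {s : Fin m}

/-- The columns of the matrix of layer `k + 1` that dropout removes, which are the neurons of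
layer `k` that it disconnects. -/
def droppedColumns (ω : Mask d h) (k : ℕ) : Finset (Fin (h k)) :=
  if hk : k < d then Finset.univ.filter fun c => ω ⟨⟨k, hk⟩, c⟩ = true else ∅

/-- The bound on the coordinates of `φ(x̂^k)` that flatness gives as long as the norm of `x̂^k` is
at most twice that of `x^k`. It serves as the cutoff of the dropout noise. -/
def activationBound (K : ℝ) (θ : Params d h) (X : Fin m → E (h 0)) (s : Fin m) (k : ℕ) : ℝ :=
  K / √(h k) * (2 * (actContraction θ X * ‖relu (pre θ (X s) k)‖))

/-- The typical size of the change that dropout causes in a pre-activation vector, relative to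
the norm of this vector. -/
def noiseSize (K K₂ p : ℝ) (θ : Params d h) (X : Fin m → E (h 0)) : ℝ :=
  12 * K * (K₂ + 1) * (actContraction θ X * √p / (√(minWidth d h) * minCushion θ X))

lemma mem_droppedColumns {k : Fin d} {c : Fin (h k)} :
    c ∈ droppedColumns ω k ↔ ω ⟨k, c⟩ = true := by
  simp [droppedColumns]

lemma measureReal_card_droppedColumns_lt_le (hp₀ : 0 ≤ p) (hp₁ : p ≤ 1) {n : ℕ} (k : Fin d)
    (hn : 1.5 * (n : ℝ) ≤ p * h k) :
    (maskLaw d h p).real {ω | (droppedColumns ω k).card < n} ≤ Real.exp (-n / 20) := by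
  let T : Finset ((k : Fin d) × Fin (h k)) :=
    Finset.univ.map (Function.Embedding.sigmaMk (β := fun k : Fin d => Fin (h k)) k)
  have hcard : ∀ ω : Mask d h,
      (droppedColumns ω k).card = (T.filter fun c => ω c = true).card := fun ω => by
    simp only [droppedColumns, k.2, dif_pos, T, Finset.filter_map, Finset.card_map]
    rfl
  simp only [hcard]
  exact measureReal_card_filter_lt_le hp₀ hp₁ (by simpa [T] using hn)

lemma relu_pre_mix_le_activationBound {k : ℕ} (hK : 0 ≤ K) (hμ : 0 < minCushion θ X)
    (hflat : FlatAt p K θ X ω) (ht : t ∈ Icc (0 : ℝ) 1) (hk : 1 ≤ k) (hkd : k < d)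
    (hclose : ‖pre (mix p θ ω t) (X s) k - pre θ (X s) k‖ ≤ ‖pre θ (X s) k‖) (c : Fin (h k)) :
    relu (pre (mix p θ ω t) (X s) k) c ≤ activationBound K θ X s k := by
  have hcoord := hflat k hk (by omega) s t ht c
  rw [hatX_self] at hcoord
  refine (le_abs_self _).trans (hcoord.trans (mul_le_mul_of_nonneg_left ?_ (by positivity)))
  have hcontraction :=
    norm_pre_le_actContraction s hk hkd (relu_pre_ne_zero hμ s hk hkd)
  calc _ ≤ ‖pre (mix p θ ω t) (X s) k‖ := norm_relu_le _
    _ ≤ ‖pre θ (X s) k‖ + ‖pre (mix p θ ω t) (X s) k - pre θ (X s) k‖ :=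
        norm_le_norm_add_norm_sub' _ _
    _ ≤ _ := by linarith

lemma norm_pre_mix_sub_pre_le_of_noiseSum {ρ Γ : ℝ} {j : ℕ} (hK : 0 ≤ K)
    (hμ : 0 < minCushion θ X) (ht : t ∈ Icc (0 : ℝ) 1) (hρ : 3 * (d : ℝ) ≤ ρ)
    (hsmooth : SmoothAt p ρ θ X ω) (hflat : FlatAt p K θ X ω) (hΓ : 0 ≤ Γ) (hΓ₁ : 3 * Γ ≤ 1)
    (hnoise : ∀ n j, n ≤ j → j ≤ d →
      ‖noiseSum p θ ω (X s) t (activationBound K θ X s) n j‖ ≤ Γ * ‖pre θ (X s) j‖)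
    (hj : 1 ≤ j) (hjd : j ≤ d) :
    ‖pre (mix p θ ω t) (X s) j - pre θ (X s) j‖ ≤ 3 * Γ * ‖pre θ (X s) j‖ := by
  refine norm_pre_sub_le_of_sum_fwdDeriv_le hΓ hρ ?_ ?_ ?_ hnoise hj hjd
  · have hd : 0 < d := hj.trans hjd
    rw [pre_succ _ _ hd, pre_succ _ _ hd, mix_zero]
    rfl
  · rintro k j hk hkj hjd v hv
    obtain ⟨n, rfl⟩ := Nat.exists_eq_add_of_le hkj
    rw [← comp_eq_fwd, ← jac_eq_fwdDeriv]
    rcases hv with rfl | rfl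
    · simpa only [hatX_self] using hsmooth (k + 1) n (by omega) hjd s t ht (k + 1) (Or.inl rfl)
    · simpa only [hatX_pred (by omega : k < d)] using
        hsmooth (k + 1) n (by omega) hjd s t ht k (Or.inr rfl)
  · exact fun k hk hkd hclose => pre_mix_succ_sub_layer hk hkd
      (relu_pre_mix_le_activationBound hK hμ hflat ht hk hkd
        (hclose.trans (mul_le_of_le_one_left (norm_nonneg _) hΓ₁)))

lemma noiseSize_pos (hK : 0 < K) (hK₂ : 0 ≤ K₂) (hp : 0 < p) (hd : 2 ≤ d)
    (hw : 0 < minWidth d h) (hμ : 0 < minCushion θ X) (s : Fin m) :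
    0 < noiseSize K K₂ p θ X := by
  have hcont := actContraction_pos hμ s hd
  rw [noiseSize]
  positivity

lemma activationBound_mul_norm_fwdDeriv_le {k : Fin d} {j : ℕ} (hK : 0 ≤ K) (hK₂ : 0 ≤ K₂)
    (hp : 0 < p) (hd : 2 ≤ d) (hw : 0 < minWidth d h) (hμ : 0 < minCushion θ X) (s : Fin m)
    (hk : 1 ≤ (k : ℕ)) (hkj : (k : ℕ) < j) (hjd : j ≤ d) :
    activationBound K θ X s k * ‖fwdDeriv θ (X s) (k + 1) j‖ * frob (θ k) ≤
      noiseSize K K₂ p θ X * ‖pre θ (X s) j‖ * (6 * (K₂ + 1) * √p)⁻¹ := by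
  have hcont := actContraction_pos hμ s hd
  have hwidth : √(minWidth d h : ℝ) ≤ √(h k) :=
    Real.sqrt_le_sqrt (by exact_mod_cast minWidth_le hk k.2)
  have hfrob : 0 ≤ frob (θ k) := Real.sqrt_nonneg _
  calc _ = 2 * K * actContraction θ X / √(h k) *
          (‖fwdDeriv θ (X s) (k + 1) j‖ * frob (θ k) * ‖relu (pre θ (X s) k)‖) := by
        rw [activationBound]
        ring
    _ ≤ 2 * K * actContraction θ X / √(minWidth d h) *
          (‖pre θ (X s) j‖ / minCushion θ X) := by
        gcongr
        exact (le_div_iff₀ hμ).2 (norm_fwdDeriv_mul_le hμ s hk hkj hjd)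
    _ = _ := by
        rw [noiseSize]
        field_simp
        ring

lemma measureReal_mul_noiseSize_le_norm_noiseSum_le {R : ℝ} {n j : ℕ} (hK : 0 < K) (hK₂ : 0 ≤ K₂)
    (hp₀ : 0 < p) (hp₁ : p ≤ 3 / 4) (hd : 2 ≤ d) (hw : 0 < minWidth d h)
    (hμ : 0 < minCushion θ X)
    (hcol : ∀ k : Fin d, 1 ≤ (k : ℕ) → ∀ c, colNorm (θ k) c ≤ K₂ * √p * frob (θ k))
    (ht : t ∈ Icc (0 : ℝ) 1) (s : Fin m) (hnj : n ≤ j) (hj : 1 ≤ j) (hjd : j ≤ d) :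
    (maskLaw d h p).real {ω | noiseSize K K₂ p θ X * ‖pre θ (X s) j‖ * R ≤
      ‖noiseSum p θ ω (X s) t (activationBound K θ X s) n j‖} ≤ Real.exp (1 + d / 4 - R) :=
  have hscale := mul_pos (noiseSize_pos hK hK₂ hp₀ hd hw hμ s)
    (norm_pos_iff.2 (pre_ne_zero hμ s hd hj hjd))
  have hcont := (actContraction_pos hμ s hd).le
  measureReal_mul_le_norm_noiseSum_le hp₀ hp₁ hK₂ ht (hnj.trans hjd) hscale
    (fun k => by rw [activationBound]; positivity) hcol (fun _ hk => frob_pos hμ s hk)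
    fun _ hk hkn => activationBound_mul_norm_fwdDeriv_le hK.le hK₂ hp₀ hd hw hμ s hk
      (hkn.trans_le hnj) hjd

lemma measureReal_exists_mul_noiseSize_le_norm_noiseSum_le {N : Finset ℝ} {R : ℝ} (hK : 0 < K)
    (hK₂ : 0 ≤ K₂) (hp₀ : 0 < p) (hp₁ : p ≤ 3 / 4) (hd : 2 ≤ d) (hw : 0 < minWidth d h)
    (hμ : 0 < minCushion θ X)
    (hcol : ∀ k : Fin d, 1 ≤ (k : ℕ) → ∀ c, colNorm (θ k) c ≤ K₂ * √p * frob (θ k))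
    (hN : ∀ t ∈ N, t ∈ Icc (0 : ℝ) 1) :
    (maskLaw d h p).real {ω | ∃ t ∈ N, ∃ s n j, n ≤ j ∧ 1 ≤ j ∧ j ≤ d ∧
      noiseSize K K₂ p θ X * ‖pre θ (X s) j‖ * R ≤
        ‖noiseSum p θ ω (X s) t (activationBound K θ X s) n j‖} ≤
      N.card * (m * ((d + 1) * ((d + 1) * Real.exp (1 + d / 4 - R)))) := by
  have := isProbabilityMeasure_bitLaw hp₀.le (hp₁.trans (by norm_num))
  have : IsFiniteMeasure (maskLaw d h p) := by rw [maskLaw]; infer_instance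
  let I : Finset (ℝ × Fin m × ℕ × ℕ) := N ×ˢ Finset.univ ×ˢ
    ((Finset.range (d + 1) ×ˢ Finset.range (d + 1)).filter fun z => z.1 ≤ z.2 ∧ 1 ≤ z.2)
  let noisy : ℝ × Fin m × ℕ × ℕ → Set (Mask d h) := fun ⟨t, s, n, j⟩ =>
    {ω | noiseSize K K₂ p θ X * ‖pre θ (X s) j‖ * R ≤
      ‖noiseSum p θ ω (X s) t (activationBound K θ X s) n j‖}
  have hI : ∀ {t s n j}, (t, s, n, j) ∈ I ↔ t ∈ N ∧ n ≤ j ∧ 1 ≤ j ∧ j ≤ d := by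
    intro t s n j
    simp only [I, Finset.mem_product, Finset.mem_filter, Finset.mem_univ, Finset.mem_range,
      true_and]
    refine and_congr_right fun _ => ?_
    omega
  have hcard : (I.card : ℝ) ≤ N.card * (m * ((d + 1) * (d + 1))) := by
    simp only [I, Finset.card_product, Finset.card_univ, Fintype.card_fin]
    exact_mod_cast Nat.mul_le_mul_left _ (Nat.mul_le_mul_left _
      ((Finset.card_filter_le _ _).trans_eq (by simp)))
  have hnoisy : ∀ z ∈ I, (maskLaw d h p).real (noisy z) ≤ Real.exp (1 + d / 4 - R) := by
    rintro ⟨t, s, n, j⟩ hz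
    obtain ⟨ht, hnj, hj, hjd⟩ := hI.1 hz
    exact measureReal_mul_noiseSize_le_norm_noiseSum_le hK hK₂ hp₀ hp₁ hd hw hμ hcol (hN t ht) s
      hnj hj hjd
  calc _ ≤ (maskLaw d h p).real (⋃ z ∈ I, noisy z) := by
        refine measureReal_mono ?_ (measure_ne_top _ _)
        rintro ω ⟨t, ht, s, n, j, hnj, hj, hjd, hω⟩
        exact mem_biUnion (hI.2 ⟨ht, hnj, hj, hjd⟩ : (t, s, n, j) ∈ I) hω
    _ ≤ I.card • Real.exp (1 + d / 4 - R) :=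
        (measureReal_biUnion_finset_le _ _).trans (Finset.sum_le_card_nsmul _ _ _ hnoisy)
    _ ≤ N.card * (m * ((d + 1) * (d + 1))) * Real.exp (1 + d / 4 - R) := by
        rw [nsmul_eq_mul]
        gcongr
    _ = _ := by ring

lemma measureReal_exists_card_droppedColumns_lt_le (hp₀ : 0 ≤ p) (hp₁ : p ≤ 1)
    (hstar_le : ∀ k, 1 ≤ k → k < d → 1.5 * (hstar k : ℝ) ≤ p * h k)
    (hstar_exp : ∀ k, 1 ≤ k → k < d → Real.exp (-(hstar k : ℝ) / 20) ≤ 1 / (8 * d)) :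
    (maskLaw d h p).real
      {ω | ∃ k, 1 ≤ k ∧ k < d ∧ (droppedColumns ω k).card < hstar k} ≤ 1 / 8 := by
  have := isProbabilityMeasure_bitLaw hp₀ hp₁
  have : IsFiniteMeasure (maskLaw d h p) := by rw [maskLaw]; infer_instance
  let few : ℕ → Set (Mask d h) := fun k => {ω | (droppedColumns ω k).card < hstar k}
  calc _ ≤ (maskLaw d h p).real (⋃ k ∈ Finset.Ico 1 d, few k) := by
        refine measureReal_mono ?_ (measure_ne_top _ _)
        rintro ω ⟨k, hk, hkd, hω⟩
        exact mem_biUnion (Finset.mem_coe.2 (Finset.mem_Ico.2 ⟨hk, hkd⟩)) hω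
    _ ≤ (Finset.Ico 1 d).card • (1 / (8 * d) : ℝ) := by
        refine (measureReal_biUnion_finset_le _ _).trans
          (Finset.sum_le_card_nsmul _ _ _ fun k hk => ?_)
        obtain ⟨hk, hkd⟩ := Finset.mem_Ico.1 hk
        exact (measureReal_card_droppedColumns_lt_le hp₀ hp₁ ⟨k, hkd⟩ (hstar_le k hk hkd)).trans
          (hstar_exp k hk hkd)
    _ ≤ d * (1 / (8 * d)) := by
        rw [nsmul_eq_mul, Nat.card_Ico]
        gcongr
        exact d.sub_le 1
    _ ≤ 1 / 8 := by
        rw [mul_one_div, mul_comm (8 : ℝ), ← div_div]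
        gcongr
        exact div_self_le_one _

lemma exists_mem_notMem_notMem_of_measureReal_add_lt {Ω : Type*} [MeasurableSpace Ω]
    {μ : Measure Ω} [IsFiniteMeasure μ] {A B G : Set Ω} (hlt : μ.real A + μ.real B < μ.real G) :
    ∃ ω ∈ G, ω ∉ A ∧ ω ∉ B := by
  by_contra! hcover
  refine hlt.not_ge ((measureReal_mono (fun ω hω => ?_)).trans (measureReal_union_le A B))
  exact or_iff_not_imp_left.2 (hcover ω hω)

lemma exists_mask_norm_net_mix_sub_le {ρ R : ℝ} {N : Finset ℝ} (hK : 0 < K) (hK₂ : 0 ≤ K₂)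
    (hp₀ : 0 < p) (hp₁ : p ≤ 3 / 4) (hd : 2 ≤ d) (hw : 0 < minWidth d h)
    (hμ : 0 < minCushion θ X)
    (hcol : ∀ k : Fin d, 1 ≤ (k : ℕ) → ∀ c, colNorm (θ k) c ≤ K₂ * √p * frob (θ k))
    (hρ : 3 * (d : ℝ) ≤ ρ)
    (hprob : 1 / 2 ≤ maskLaw d h p {ω | SmoothAt p ρ θ X ω ∧ FlatAt p K θ X ω})
    (hstar_le : ∀ k, 1 ≤ k → k < d → 1.5 * (hstar k : ℝ) ≤ p * h k)
    (hstar_exp : ∀ k, 1 ≤ k → k < d → Real.exp (-(hstar k : ℝ) / 20) ≤ 1 / (8 * d))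
    (hN : ∀ t ∈ N, t ∈ Icc (0 : ℝ) 1)
    (hunion : N.card * (m * ((d + 1) * ((d + 1) * Real.exp (1 + d / 4 - R)))) ≤ 1 / 4)
    (hR : 0 ≤ R) (hsmall : 3 * (noiseSize K K₂ p θ X * R) ≤ 1) :
    ∃ ω : Mask d h, (∀ k, 1 ≤ k → k < d → hstar k ≤ (droppedColumns ω k).card) ∧
      ∀ t ∈ N, ∀ s, ‖net (mix p θ ω t) (X s) - net θ (X s)‖ ≤
        3 * (noiseSize K K₂ p θ X * R) * ‖net θ (X s)‖ := by
  have := isProbabilityMeasure_bitLaw hp₀.le (hp₁.trans (by norm_num))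
  have : IsFiniteMeasure (maskLaw d h p) := by rw [maskLaw]; infer_instance
  have hhalf : 1 / 2 ≤ (maskLaw d h p).real {ω | SmoothAt p ρ θ X ω ∧ FlatAt p K θ X ω} := by
    simpa [measureReal_def] using ENNReal.toReal_mono (measure_ne_top _ _) hprob
  have hnoisy := (measureReal_exists_mul_noiseSize_le_norm_noiseSum_le hK hK₂ hp₀ hp₁ hd hw hμ hcol
    hN).trans hunion
  have hfew := measureReal_exists_card_droppedColumns_lt_le hp₀.le (hp₁.trans (by norm_num))
    hstar_le hstar_exp
  obtain ⟨ω, ⟨hsmooth, hflat⟩, hω_noisy, hω_few⟩ :=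
    exists_mem_notMem_notMem_of_measureReal_add_lt
      ((add_le_add hnoisy hfew).trans_lt (lt_of_lt_of_le (by norm_num) hhalf))
  have hcard : ∀ k, 1 ≤ k → k < d → hstar k ≤ (droppedColumns ω k).card := fun k hk hkd =>
    not_lt.1 fun hlt => hω_few ⟨k, hk, hkd, hlt⟩
  refine ⟨ω, hcard, fun t ht s => ?_⟩
  have hΓ := mul_nonneg (noiseSize_pos hK hK₂ hp₀ hd hw hμ s).le hR
  refine norm_pre_mix_sub_pre_le_of_noiseSum hK.le hμ (hN t ht) hρ hsmooth hflat hΓ hsmall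
    (fun n j hnj hjd => ?_) (by omega) le_rfl
  rcases j.eq_zero_or_pos with rfl | hj
  · rw [noiseSum, Finset.Ico_eq_empty (by omega), Finset.sum_empty, norm_zero]
    exact mul_nonneg hΓ (norm_nonneg _)
  · rw [mul_right_comm]
    exact (not_le.1 fun hle => hω_noisy ⟨t, ht, s, n, j, hnj, hj, hjd, hle⟩).le

end GoodMask

section LogFactor

variable {d m : ℕ} {h : ℕ → ℕ} {β ε : ℝ} {θ : Params d h} {X : Fin m → E (h 0)}

lemma exp_logFactor (hβ : 0 ≤ β) (hε : 0 ≤ ε) :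
    Real.exp (logFactor β ε θ X) = 2 + m + d + β + (⨆ s, ‖X s‖) + 1 / ε +
      ∑ k : Fin d, ((h (k + 1) : ℝ) + opNorm (θ k)) := by
  have hX : 0 ≤ ⨆ s, ‖X s‖ := Real.iSup_nonneg fun s => norm_nonneg _
  have hsum : 0 ≤ ∑ k : Fin d, ((h (k + 1) : ℝ) + opNorm (θ k)) :=
    Finset.sum_nonneg fun k _ => add_nonneg (Nat.cast_nonneg _) (opNorm_nonneg _)
  rw [logFactor, Real.exp_log (by positivity)]

lemma add_le_exp_logFactor (hβ : 0 ≤ β) (hε : 0 ≤ ε) :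
    2 + m + d + β + 1 / ε ≤ Real.exp (logFactor β ε θ X) := by
  have hX : 0 ≤ ⨆ s, ‖X s‖ := Real.iSup_nonneg fun s => norm_nonneg _
  have hsum : 0 ≤ ∑ k : Fin d, ((h (k + 1) : ℝ) + opNorm (θ k)) :=
    Finset.sum_nonneg fun k _ => add_nonneg (Nat.cast_nonneg _) (opNorm_nonneg _)
  rw [exp_logFactor hβ hε]
  linarith

lemma norm_le_exp_logFactor (hβ : 0 ≤ β) (hε : 0 ≤ ε) (s : Fin m) :
    ‖X s‖ ≤ Real.exp (logFactor β ε θ X) := by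
  have hsum : 0 ≤ ∑ k : Fin d, ((h (k + 1) : ℝ) + opNorm (θ k)) :=
    Finset.sum_nonneg fun k _ => add_nonneg (Nat.cast_nonneg _) (opNorm_nonneg _)
  have hother : 0 ≤ 2 + m + d + β + 1 / ε := by positivity
  have hX := le_ciSup (f := fun s => ‖X s‖) (finite_range _).bddAbove s
  rw [exp_logFactor hβ hε]
  linarith

lemma width_add_opNorm_le_exp_logFactor (hβ : 0 ≤ β) (hε : 0 ≤ ε) (k : Fin d) :
    (h (k + 1) : ℝ) + opNorm (θ k) ≤ Real.exp (logFactor β ε θ X) := by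
  have hX : 0 ≤ ⨆ s, ‖X s‖ := Real.iSup_nonneg fun s => norm_nonneg _
  have hother : 0 ≤ 2 + m + d + β + 1 / ε := by positivity
  have hterm : (h (k + 1) : ℝ) + opNorm (θ k) ≤
      ∑ k : Fin d, ((h (k + 1) : ℝ) + opNorm (θ k)) :=
    Finset.single_le_sum (f := fun k : Fin d => (h (k + 1) : ℝ) + opNorm (θ k))
      (fun k _ => add_nonneg (Nat.cast_nonneg _) (opNorm_nonneg _)) (Finset.mem_univ k)
  rw [exp_logFactor hβ hε]
  linarith

lemma one_div_exp_logFactor_le {p : ℝ} {n : ℕ} (hβ : 0 ≤ β) (hε : 0 ≤ ε) (hd : 0 < d)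
    (hn : 1 ≤ n) (hnp : 1.5 * (n : ℝ) ≤ p * h 1) :
    1 / Real.exp (logFactor β ε θ X) ≤ p := by
  have hn' : (1 : ℝ) ≤ n := by exact_mod_cast hn
  have hp : 0 < p := by
    by_contra! hp
    have := mul_nonpos_of_nonpos_of_nonneg hp (Nat.cast_nonneg (α := ℝ) (h 1))
    linarith
  have hwidth : (h 1 : ℝ) ≤ Real.exp (logFactor β ε θ X) := by
    have := width_add_opNorm_le_exp_logFactor (θ := θ) (X := X) hβ hε ⟨0, hd⟩
    linarith [opNorm_nonneg (θ ⟨0, hd⟩)]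
  rw [div_le_iff₀ (Real.exp_pos _)]
  linarith [mul_le_mul_of_nonneg_left hwidth hp.le]

lemma one_div_exp_logFactor_mul_self_le {p : ℝ} (hβ : 0 ≤ β) (hε : 0 < ε) (hp₁ : p ≤ 1)
    (hpΛ : 1 / Real.exp (logFactor β ε θ X) ≤ p) :
    1 / Real.exp (logFactor β ε θ X) * (1 / Real.exp (logFactor β ε θ X)) ≤ √p * ε := by
  have hp₀ : 0 ≤ p := (one_div_nonneg.2 (Real.exp_pos _).le).trans hpΛ
  have hpsqrt : p ≤ √p :=
    Real.le_sqrt_of_sq_le ((sq p).trans_le (mul_le_of_le_one_left hp₀ hp₁))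
  have hεΛ : 1 / ε ≤ Real.exp (logFactor β ε θ X) :=
    (le_add_of_nonneg_left (by positivity)).trans (add_le_exp_logFactor hβ hε.le)
  gcongr
  · exact hpΛ.trans hpsqrt
  · exact (one_div_le hε (Real.exp_pos _)).1 hεΛ

end LogFactor

section Grid

variable {d m M : ℕ} {t Q Λ : ℝ}

/-- The points `i / M` with `0 ≤ i ≤ M`, at which the union bound controls the network along a
segment; Lipschitz continuity takes care of the points in between. -/
def gridPoints (M : ℕ) : Finset ℝ := (Finset.range (M + 1)).image fun i : ℕ => (i : ℝ) / M

lemma card_gridPoints_le (M : ℕ) : (gridPoints M).card ≤ M + 1 :=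
  Finset.card_image_le.trans_eq (Finset.card_range _)

lemma mem_Icc_of_mem_gridPoints (ht : t ∈ gridPoints M) : t ∈ Icc (0 : ℝ) 1 := by
  obtain ⟨i, hi, rfl⟩ := Finset.mem_image.1 ht
  have hiM : (i : ℝ) ≤ M := by exact_mod_cast Nat.lt_succ_iff.1 (Finset.mem_range.1 hi)
  exact ⟨by positivity, div_le_one_of_le₀ hiM (Nat.cast_nonneg M)⟩

lemma exists_mem_gridPoints_abs_sub_le (hM : 0 < M) (ht : t ∈ Icc (0 : ℝ) 1) :
    ∃ t' ∈ gridPoints M, |t - t'| ≤ 1 / M := by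
  have hM' : (0 : ℝ) < M := by exact_mod_cast hM
  have hfloor := Nat.floor_le (mul_nonneg ht.1 hM'.le)
  have hlt := Nat.lt_floor_add_one (t * M)
  have hle : ⌊t * M⌋₊ ≤ M :=
    Nat.floor_le_of_le (mul_le_of_le_one_left hM'.le ht.2)
  refine ⟨(⌊t * M⌋₊ : ℝ) / M,
    Finset.mem_image_of_mem _ (Finset.mem_range.2 (Nat.lt_succ_of_le hle)), ?_⟩
  have hsub : t - (⌊t * M⌋₊ : ℝ) / M = (t * M - ⌊t * M⌋₊) / M := by field_simp
  rw [hsub, abs_of_nonneg (div_nonneg (by linarith) hM'.le)]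
  gcongr
  linarith

lemma card_gridPoints_mul_exp_le (hd : 2 ≤ d) (hΛ : 2 + m + d ≤ Real.exp Λ)
    (hM : (M : ℝ) + 1 ≤ Real.exp Λ ^ (2 * d + 6)) :
    ((gridPoints M).card : ℝ) * (m * ((d + 1) * ((d + 1) *
      Real.exp (1 + d / 4 - (d + (2 * d + 11) * Λ))))) ≤ 1 / 4 := by
  have hd' : (2 : ℝ) ≤ d := by exact_mod_cast hd
  have hcard : ((gridPoints M).card : ℝ) ≤ Real.exp Λ ^ (2 * d + 6) :=
    le_trans (by exact_mod_cast card_gridPoints_le M) hM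
  have hexp : Real.exp (1 + d / 4 - (d + (2 * d + 11) * Λ)) ≤
      (Real.exp Λ ^ (2 * d + 11))⁻¹ := by
    rw [← Real.exp_nat_mul, ← Real.exp_neg, Real.exp_le_exp]
    push_cast
    linarith
  generalize Real.exp Λ = Q at *
  have hQ : 0 < Q := by linarith
  calc _ ≤ Q ^ (2 * d + 6) * (Q * (Q * (Q * (Q ^ (2 * d + 11))⁻¹))) := by
        gcongr <;> linarith
    _ = (Q ^ 2)⁻¹ := by
        field_simp
        ring
    _ ≤ 1 / 4 := by
        rw [one_div]
        exact inv_anti₀ (by norm_num) (by nlinarith)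

lemma exists_nat_between_pow (hQ : 3 ≤ Q) (n : ℕ) :
    ∃ M : ℕ, Q ^ n ≤ M ∧ (M : ℝ) + 1 ≤ Q ^ (n + 1) := by
  have hpow : 1 ≤ Q ^ n := one_le_pow₀ (by linarith)
  have hceil : (⌈Q ^ n⌉₊ : ℝ) < Q ^ n + 1 := Nat.ceil_lt_add_one (by linarith)
  refine ⟨⌈Q ^ n⌉₊, Nat.le_ceil _, ?_⟩
  rw [pow_succ]
  nlinarith

lemma mul_lipschitz_error_le {β : ℝ} (hQ : 4 ≤ Q) (hd : (d : ℝ) ≤ Q) (hβ : β ≤ Q)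
    (hM : Q ^ (2 * d + 5) ≤ M) :
    β * (d * (4 * Q) ^ d * (1 / M) * Q) ≤ 1 / Q * (1 / Q) := by
  calc β * (d * (4 * Q) ^ d * (1 / M) * Q)
      ≤ Q * (Q * (Q * Q) ^ d * (1 / Q ^ (2 * d + 5)) * Q) := by gcongr
    _ = 1 / Q * (1 / Q) := by
        rw [← pow_two, ← pow_mul]
        field_simp
        ring

lemma exp_neg_div_le {w : ℝ} (hd : 2 ≤ d) (hw : 80 * Real.log (d + 1) ≤ w) :
    Real.exp (-w / 20) ≤ 1 / (8 * d) := by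
  have hd' : (2 : ℝ) ≤ d := by exact_mod_cast hd
  calc Real.exp (-w / 20) ≤ Real.exp (-((4 : ℕ) * Real.log (d + 1))) :=
        Real.exp_le_exp.2 (by push_cast; linarith)
    _ = 1 / ((d : ℝ) + 1) ^ 4 := by
        rw [Real.exp_neg, Real.exp_nat_mul, Real.exp_log (by linarith), one_div]
    _ ≤ 1 / (8 * d) := by
        gcongr
        nlinarith [pow_le_pow_left₀ (by norm_num) (by linarith : (2 : ℝ) ≤ d + 1) 3]

end Grid

section Main

variable {d m : ℕ} {h hstar : ℕ → ℕ} {K K₂ β ε p : ℝ} {θ : Params d h} {X : Fin m → E (h 0)}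
  {Y : Fin m → E (h d)} {l : E (h d) → E (h d) → ℝ}

lemma empLoss_le_add {a b : ℕ} {l : E b → E b → ℝ} {X : Fin m → E a} {Y : Fin m → E b} {δ : ℝ}
    {f g : E a → E b} (hm : 1 ≤ m) (hβ : 0 ≤ β) (hl : ∀ y u v, |l y u - l y v| ≤ β * ‖u - v‖)
    (hfg : ∀ s, ‖f (X s) - g (X s)‖ ≤ δ) : empLoss l X Y f ≤ empLoss l X Y g + β * δ := by
  calc empLoss l X Y f ≤ 1 / (m : ℝ) * ∑ s, (l (Y s) (g (X s)) + β * δ) := by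
        rw [empLoss]
        gcongr with s
        exact sub_le_iff_le_add'.1 ((le_abs_self _).trans
          ((hl _ _ _).trans (mul_le_mul_of_nonneg_left (hfg s) hβ)))
    _ = _ := by
        rw [Finset.sum_add_distrib, Finset.sum_const, Finset.card_univ, Fintype.card_fin,
          nsmul_eq_mul, empLoss]
        field_simp

lemma segment_zero_subset_lossSublevel (hm : 1 ≤ m) (hβ : 0 ≤ β)
    (hl : ∀ y u v, |l y u - l y v| ≤ β * ‖u - v‖) :
    segment ℝ θ 0 ⊆
      lossSublevel l X Y (empLoss l X Y (net θ) + β * ⨆ s, ‖net θ (X s)‖) := by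
  refine segment_subset_iff_forall.2 fun u hu => empLoss_le_add hm hβ hl fun s => ?_
  have hu' : 0 ≤ 1 - u := sub_nonneg.2 hu.2
  have hpow : (1 - u) ^ d ≤ 1 := pow_le_one₀ hu' (sub_le_self _ hu.1)
  have hsub : net ((1 - u) • θ + u • 0) (X s) - net θ (X s) =
      ((1 - u) ^ d - 1) • net θ (X s) := by
    rw [smul_zero, add_zero, net, net, pre_smul (X s) hu' le_rfl, sub_smul, one_smul]
  calc _ = (1 - (1 - u) ^ d) * ‖net θ (X s)‖ := by
        rw [hsub, norm_smul, Real.norm_eq_abs, abs_sub_comm, abs_of_nonneg (sub_nonneg.2 hpow)]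
    _ ≤ ‖net θ (X s)‖ :=
        mul_le_of_le_one_left (norm_nonneg _) (sub_le_self _ (pow_nonneg hu' d))
    _ ≤ _ := le_ciSup (f := fun s => ‖net θ (X s)‖) (finite_range _).bddAbove s

lemma segment_dropUpTo_subset_lossSublevel {M : ℕ} {a b δ : ℝ} {ω : Mask d h} (hm : 1 ≤ m)
    (hβ : 0 ≤ β) (hl : ∀ y u v, |l y u - l y v| ≤ β * ‖u - v‖) (hp₀ : 0 ≤ p) (hp₁ : p ≤ 3 / 4)
    (hM : 0 < M) (ha : ∀ k, opNorm (θ k) ≤ a) (ha₀ : 0 ≤ a) (hb : ∀ s, ‖X s‖ ≤ b)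
    (hgrid : ∀ t ∈ gridPoints M, ∀ s, ‖net (mix p θ ω t) (X s) - net θ (X s)‖ ≤ δ) :
    segment ℝ θ (dropUpTo p θ ω d) ⊆
      lossSublevel l X Y (empLoss l X Y (net θ) + β * (d * (4 * a) ^ d * (1 / M) * b + δ)) := by
  refine segment_subset_iff_forall.2 fun u hu => empLoss_le_add hm hβ hl fun s => ?_
  have hmix : (1 - u) • θ + u • dropUpTo p θ ω d = mix p θ ω (1 - u) := by
    rw [mix, sub_sub_cancel]
  have ht : 1 - u ∈ Icc (0 : ℝ) 1 := ⟨sub_nonneg.2 hu.2, sub_le_self _ hu.1⟩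
  obtain ⟨t, htM, hut⟩ := exists_mem_gridPoints_abs_sub_le hM ht
  rw [hmix]
  calc _ ≤ ‖net (mix p θ ω (1 - u)) (X s) - net (mix p θ ω t) (X s)‖ +
          ‖net (mix p θ ω t) (X s) - net θ (X s)‖ := norm_sub_le_norm_sub_add_norm_sub _ _ _
    _ ≤ d * (4 * a) ^ d * |1 - u - t| * ‖X s‖ + δ :=
        add_le_add (norm_pre_mix_sub_le (X s) hp₀ hp₁ ht (mem_Icc_of_mem_gridPoints htM) ha le_rfl)
          (hgrid t htM s)
    _ ≤ _ := by
        gcongr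
        exact hb s

lemma deadOn_dropUpTo (p : ℝ) (θ : Params d h) (ω : Mask d h) :
    DeadOn (fun k => droppedColumns ω k) (dropUpTo p θ ω d) := by
  intro k hk r j hj
  have hdropped : ω ⟨k, j⟩ = true := mem_droppedColumns.1 hj
  have hlayer : 2 ≤ (k : ℕ) + 1 ∧ (k : ℕ) + 1 ≤ d := by omega
  simp [dropUpTo, hlayer, dropLayer, hdropped]

lemma stabilityNumber_nonneg (hβ : 0 ≤ β) (hμ : 0 < minCushion θ X) :
    0 ≤ stabilityNumber β θ X := by
  have hnet : 0 ≤ ⨆ s, ‖net θ (X s)‖ := Real.iSup_nonneg fun s => norm_nonneg _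
  have hcont : 0 ≤ actContraction θ X := Real.iSup_nonneg fun z => by positivity
  rw [stabilityNumber]
  positivity

lemma noiseSize_mul_le (hK : 0 ≤ K) (hK₂ : 0 ≤ K₂) (hβ : 0 ≤ β) (hd : 1 ≤ d)
    (hμ : 0 < minCushion θ X) :
    noiseSize K K₂ p θ X * d * (β * ⨆ s, ‖net θ (X s)‖) ≤
      12 * K * (K₂ + 1) * (√p * stabilityNumber β θ X) := by
  have hnet : 0 ≤ ⨆ s, ‖net θ (X s)‖ := Real.iSup_nonneg fun s => norm_nonneg _
  have hcont : 0 ≤ actContraction θ X := Real.iSup_nonneg fun z => by positivity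
  have hpow : (d : ℝ) ≤ (d : ℝ) ^ (3 / 2 : ℝ) :=
    Real.self_le_rpow_of_one_le (by exact_mod_cast hd) (by norm_num)
  calc _ = 12 * K * (K₂ + 1) * (√p * (β * actContraction θ X * d * (⨆ s, ‖net θ (X s)‖) /
          (√(minWidth d h) * minCushion θ X))) := by
        rw [noiseSize]
        ring
    _ ≤ _ := by
        rw [stabilityNumber]
        gcongr

lemma noiseSize_mul_log_le {Λ : ℝ} (hK : 0 ≤ K) (hK₂ : 0 ≤ K₂) (hβ : 0 ≤ β) (hd : 2 ≤ d)
    (hμ : 0 < minCushion θ X) (hΛ : 1 ≤ Λ) (hε : stabilityNumber β θ X ≤ ε) :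
    3 * (noiseSize K K₂ p θ X * (d + (2 * d + 11) * Λ)) * (β * ⨆ s, ‖net θ (X s)‖) ≤
      324 * K * (K₂ + 1) * Λ * (√p * ε) := by
  have hd' : (2 : ℝ) ≤ d := by exact_mod_cast hd
  have hnet : 0 ≤ ⨆ s, ‖net θ (X s)‖ := Real.iSup_nonneg fun s => norm_nonneg _
  have hcont : 0 ≤ actContraction θ X := Real.iSup_nonneg fun z => by positivity
  have hnoise : 0 ≤ noiseSize K K₂ p θ X := by
    rw [noiseSize]
    positivity
  have hlog : d + (2 * d + 11) * Λ ≤ 9 * d * Λ := by nlinarith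
  calc _ ≤ 3 * (noiseSize K K₂ p θ X * (9 * d * Λ)) * (β * ⨆ s, ‖net θ (X s)‖) := by gcongr
    _ = 27 * Λ * (noiseSize K K₂ p θ X * d * (β * ⨆ s, ‖net θ (X s)‖)) := by ring
    _ ≤ 27 * Λ * (12 * K * (K₂ + 1) * (√p * stabilityNumber β θ X)) :=
        mul_le_mul_of_nonneg_left (noiseSize_mul_le hK hK₂ hβ (by omega) hμ) (by positivity)
    _ = 324 * K * (K₂ + 1) * Λ * (√p * stabilityNumber β θ X) := by ring
    _ ≤ _ := by gcongr

lemma exists_mask_segment_dropUpTo_subset {ρ Λ : ℝ} (hK : 0 < K) (hK₂ : 0 ≤ K₂) (hd : 2 ≤ d)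
    (hm : 1 ≤ m) (hβ : 0 ≤ β) (hl : ∀ y u v, |l y u - l y v| ≤ β * ‖u - v‖) (hp₀ : 0 < p)
    (hp₁ : p ≤ 3 / 4) (hw : 0 < minWidth d h) (hμ : 0 < minCushion θ X)
    (hcol : ∀ k : Fin d, 1 ≤ (k : ℕ) → ∀ c, colNorm (θ k) c ≤ K₂ * √p * frob (θ k))
    (hρ : 3 * (d : ℝ) ≤ ρ)
    (hprob : 1 / 2 ≤ maskLaw d h p {ω | SmoothAt p ρ θ X ω ∧ FlatAt p K θ X ω})
    (hstar_le : ∀ k, 1 ≤ k → k < d → 1.5 * (hstar k : ℝ) ≤ p * h k)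
    (hstar_exp : ∀ k, 1 ≤ k → k < d → Real.exp (-(hstar k : ℝ) / 20) ≤ 1 / (8 * d))
    (hΛ₀ : 0 ≤ Λ) (hΛ : 2 + m + d + β ≤ Real.exp Λ) (hθΛ : ∀ k, opNorm (θ k) ≤ Real.exp Λ)
    (hXΛ : ∀ s, ‖X s‖ ≤ Real.exp Λ)
    (hsmall : 3 * (noiseSize K K₂ p θ X * (d + (2 * d + 11) * Λ)) ≤ 1) :
    ∃ ω : Mask d h, (∀ k, 1 ≤ k → k < d → hstar k ≤ (droppedColumns ω k).card) ∧
      segment ℝ θ (dropUpTo p θ ω d) ⊆ lossSublevel l X Y (empLoss l X Y (net θ) +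
        (1 / Real.exp Λ * (1 / Real.exp Λ) +
          3 * (noiseSize K K₂ p θ X * (d + (2 * d + 11) * Λ)) *
            (β * ⨆ s, ‖net θ (X s)‖))) := by
  have hd' : (2 : ℝ) ≤ d := by exact_mod_cast hd
  have hm' : (1 : ℝ) ≤ m := by exact_mod_cast hm
  have hnoise := noiseSize_pos hK hK₂ hp₀ hd hw hμ ⟨0, hm⟩
  obtain ⟨M, hΛM, hMΛ⟩ :=
    exists_nat_between_pow (by linarith : 3 ≤ Real.exp Λ) (2 * d + 5)
  have hM : 0 < M := by exact_mod_cast (pow_pos (Real.exp_pos Λ) _).trans_le hΛM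
  obtain ⟨ω, hcard, hclose⟩ := exists_mask_norm_net_mix_sub_le hK hK₂ hp₀ hp₁ hd hw hμ hcol hρ
    hprob hstar_le hstar_exp (fun t => mem_Icc_of_mem_gridPoints)
    (card_gridPoints_mul_exp_le hd (by linarith) hMΛ) (by positivity) hsmall
  refine ⟨ω, hcard, (segment_dropUpTo_subset_lossSublevel hm hβ hl hp₀.le hp₁ hM hθΛ
    (Real.exp_pos Λ).le hXΛ fun t ht s => (hclose t ht s).trans (mul_le_mul_of_nonneg_left
      (le_ciSup (f := fun s => ‖net θ (X s)‖) (finite_range _).bddAbove s)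
      (by positivity))).trans (lossSublevel_mono ?_)⟩
  have hlip := mul_lipschitz_error_le (d := d) (β := β) (by linarith : 4 ≤ Real.exp Λ)
    (by linarith) (by linarith) hΛM
  linarith

lemma exists_deadOn_of_lt {W : ℝ} (hK : 0 < K) (hK₂ : 0 ≤ K₂) (hd : 2 ≤ d) (hm : 1 ≤ m)
    (hβ : 0 ≤ β) (hl : ∀ y u v, |l y u - l y v| ≤ β * ‖u - v‖)
    (hpΛ : 1 / Real.exp (logFactor β ε θ X) ≤ p) (hp₁ : p ≤ 3 / 4) (hw : 0 < minWidth d h)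
    (hθ : NoiseStable W K p β ε θ X)
    (hcol : ∀ k : Fin d, 1 ≤ (k : ℕ) → ∀ c, colNorm (θ k) c ≤ K₂ * √p * frob (θ k))
    (hstar_le : ∀ k, 1 ≤ k → k < d → 1.5 * (hstar k : ℝ) ≤ p * h k)
    (hstar_exp : ∀ k, 1 ≤ k → k < d → Real.exp (-(hstar k : ℝ) / 20) ≤ 1 / (8 * d))
    (hlarge : (324 * K * (K₂ + 1) + 1) * logFactor β ε θ X * (√p * ε) <
      β * ⨆ s, ‖net θ (X s)‖) :
    ∃ (θ' : Params d h) (D : ∀ k, Finset (Fin (h k))),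
      segment ℝ θ θ' ⊆ lossSublevel l X Y (empLoss l X Y (net θ) +
        (324 * K * (K₂ + 1) + 1) * logFactor β ε θ X * (√p * ε)) ∧
      (∀ k, 1 ≤ k → k < d → hstar k ≤ (D k).card) ∧ DeadOn (fun k => D k) θ' := by
  have hμ := hθ.cushion_pos
  have hε₀ : 0 ≤ ε := (stabilityNumber_nonneg hβ hμ).trans hθ.number_le
  have hsum := add_le_exp_logFactor (θ := θ) (X := X) hβ hε₀
  have hp₀ : 0 < p := (one_div_pos.2 (Real.exp_pos _)).trans_le hpΛ
  have hεinv : 0 ≤ 1 / ε := by positivity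
  have hd' : (2 : ℝ) ≤ d := by exact_mod_cast hd
  have hm' : (1 : ℝ) ≤ m := by exact_mod_cast hm
  have hΛ : 1 ≤ logFactor β ε θ X := Real.exp_le_exp.1 (by linarith [Real.exp_one_lt_d9])
  have hnoise := noiseSize_pos hK hK₂ hp₀ hd hw hμ ⟨0, hm⟩
  have hloss : 0 < β * ⨆ s, ‖net θ (X s)‖ := lt_of_le_of_lt (by positivity) hlarge
  have herror := noiseSize_mul_log_le (p := p) hK.le hK₂ hβ hd hμ hΛ hθ.number_le
  have hε : 0 < ε := by
    have hpos : 0 < 324 * K * (K₂ + 1) * logFactor β ε θ X * (√p * ε) :=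
      (mul_pos (by positivity) hloss).trans_le herror
    exact pos_of_mul_pos_right (pos_of_mul_pos_right hpos (by positivity)) (Real.sqrt_nonneg p)
  have hlog : √p * ε ≤ logFactor β ε θ X * (√p * ε) :=
    le_mul_of_one_le_left (by positivity) hΛ
  have hpε : 0 ≤ √p * ε := by positivity
  have hsmall := le_of_mul_le_mul_right
    (herror.trans (by linarith : _ ≤ 1 * (β * ⨆ s, ‖net θ (X s)‖))) hloss
  have hgrid := one_div_exp_logFactor_mul_self_le hβ hε (hp₁.trans (by norm_num)) hpΛ
  obtain ⟨ρ, hρ, hprob⟩ := hθ.smooth_flat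
  obtain ⟨ω, hcard, hsegment⟩ := exists_mask_segment_dropUpTo_subset (l := l) (Y := Y) hK hK₂ hd hm
    hβ hl hp₀ hp₁ hw hμ hcol hρ hprob hstar_le hstar_exp (zero_le_one.trans hΛ) (by linarith)
    (fun k => (le_add_of_nonneg_left (Nat.cast_nonneg _)).trans
      (width_add_opNorm_le_exp_logFactor hβ hε₀ k))
    (norm_le_exp_logFactor hβ hε₀) hsmall
  exact ⟨dropUpTo p θ ω d, droppedColumns ω, hsegment.trans (lossSublevel_mono (by linarith)),
    hcard, deadOn_dropUpTo p θ ω⟩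

lemma exists_deadOn {W : ℝ} (hK : 0 < K) (hK₂ : 0 ≤ K₂) (hd : 2 ≤ d) (hm : 1 ≤ m)
    (hl : ∀ y u v, |l y u - l y v| ≤ β * ‖u - v‖)
    (hstar_width : 80 * Real.log (d + 1) ≤ minWidth d hstar)
    (hp : ∀ i, 1 ≤ i → i ≤ d - 1 → 1.5 * ((hstar i : ℝ) / h i) ≤ p) (hp₁ : p ≤ 3 / 4)
    (hw : 0 < W) (hθ : NoiseStable W K p β ε θ X)
    (hcol : ∀ k : Fin d, 1 ≤ (k : ℕ) → ∀ c, colNorm (θ k) c ≤ K₂ * √p * frob (θ k)) :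
    ∃ (θ' : Params d h) (D : ∀ k, Finset (Fin (h k))),
      segment ℝ θ θ' ⊆ lossSublevel l X Y (empLoss l X Y (net θ) +
        (324 * K * (K₂ + 1) + 1) * logFactor β ε θ X * (√p * ε)) ∧
      (∀ k, 1 ≤ k → k < d → hstar k ≤ (D k).card) ∧ DeadOn (fun k => D k) θ' := by
  have hβ : 0 ≤ β := by
    have hnet := norm_pos_iff.2 (pre_ne_zero hθ.cushion_pos ⟨0, hm⟩ hd (by omega) le_rfl)
    have := (abs_nonneg _).trans (hl 0 (net θ (X ⟨0, hm⟩)) 0)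
    rw [sub_zero] at this
    exact nonneg_of_mul_nonneg_left this hnet
  have hwidth : 0 < minWidth d h := by exact_mod_cast hw.trans_le hθ.width
  have hstar_ge : ∀ k, 1 ≤ k → k < d → 80 * Real.log (d + 1) ≤ hstar k := fun k hk hkd =>
    hstar_width.trans (by exact_mod_cast minWidth_le hk hkd)
  have hstar_le : ∀ k, 1 ≤ k → k < d → 1.5 * (hstar k : ℝ) ≤ p * h k := fun k hk hkd => by
    have hk₀ : (0 : ℝ) < h k := by exact_mod_cast hwidth.trans_le (minWidth_le hk hkd)
    rw [← div_le_iff₀ hk₀, mul_div_assoc]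
    exact hp k hk (by omega)
  by_cases hsmall : β * ⨆ s, ‖net θ (X s)‖ ≤
      (324 * K * (K₂ + 1) + 1) * logFactor β ε θ X * (√p * ε)
  · refine ⟨0, fun _ => Finset.univ, (segment_zero_subset_lossSublevel hm hβ hl).trans
      (lossSublevel_mono (by linarith)), fun k hk hkd => ?_, fun _ _ _ _ _ => rfl⟩
    have := hstar_le k hk hkd
    have := mul_le_mul_of_nonneg_right hp₁ (Nat.cast_nonneg (α := ℝ) (h k))
    rw [Finset.card_fin]
    exact_mod_cast (by linarith : (hstar k : ℝ) ≤ h k)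
  · have hε := (stabilityNumber_nonneg hβ hθ.cushion_pos).trans hθ.number_le
    have hlog : 0 < Real.log (d + 1) := Real.log_pos (by norm_cast; omega)
    have hstar_one : 1 ≤ hstar 1 := by
      exact_mod_cast (by positivity : (0 : ℝ) < 80 * Real.log (d + 1)).trans_le
        (hstar_ge 1 le_rfl hd)
    exact exists_deadOn_of_lt hK hK₂ hd hm hβ hl
      (one_div_exp_logFactor_le hβ hε (by omega) hstar_one (hstar_le 1 le_rfl hd)) hp₁ hwidth hθ
      hcol hstar_le (fun k hk hkd => exp_neg_div_le hd (hstar_ge k hk hkd)) (not_le.1 hsmall)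

end Main

end DeepNet

end

/-- The hidden constants `K₁` (flatness) and `K₂` (column balance) determine the constants and
exponents `C₀, k₀` (width bound) and `C, k` (error bound), uniformly in everything else. -/
theorem theorem3 (K₁ K₂ : ℝ) (hK₁ : 0 < K₁) (hK₂ : 0 < K₂) :
    ∃ (C₀ C : ℝ) (k₀ k : ℕ), 0 < C₀ ∧ 0 < C ∧
      ∀ (d m : ℕ) (h hstar : ℕ → ℕ) (hin : hstar 0 = h 0) (hout : hstar d = h d)
        (l : DeepNet.E (h d) → DeepNet.E (h d) → ℝ) (β ε p : ℝ)
        (X : Fin m → DeepNet.E (h 0)) (Y : Fin m → DeepNet.E (h d))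
        (θA θB : DeepNet.Params d h) (θstar : DeepNet.Params d hstar),
        2 ≤ d → 1 ≤ m →
        (∀ y, ConvexOn ℝ Set.univ (l y)) →
        (∀ y u v, |l y u - l y v| ≤ β * ‖u - v‖) →
        C₀ * Real.log (d + 1) ^ k₀ ≤ DeepNet.minWidth d hstar →
        (∀ i, 1 ≤ i → i ≤ d - 1 → 1.5 * ((hstar i : ℝ) / h i) ≤ p) → p ≤ 3 / 4 →
        DeepNet.NoiseStable (C₀ * Real.log (d + 1) ^ k₀) K₁ p β ε θA X →
        DeepNet.NoiseStable (C₀ * Real.log (d + 1) ^ k₀) K₁ p β ε θB X →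
        (∀ i : Fin d, 1 ≤ (i : ℕ) → ∀ j : Fin (h i),
          DeepNet.colNorm (θA i) j ≤ K₂ * √p * DeepNet.frob (θA i) ∧
          DeepNet.colNorm (θB i) j ≤ K₂ * √p * DeepNet.frob (θB i)) →
        ∃ γ : Path θA θB, DeepNet.HasSegments 13 γ ∧
          ∀ t, DeepNet.empLoss l X Y (DeepNet.net (γ t)) ≤
            max (max
              (DeepNet.empLoss l X Y (DeepNet.net θA) +
                C * DeepNet.logFactor β ε θA X ^ k * (√p * ε))
              (DeepNet.empLoss l X Y (DeepNet.net θB) +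
                C * DeepNet.logFactor β ε θB X ^ k * (√p * ε)))
              (DeepNet.empLoss l X Y fun x =>
                DeepNet.castE hout (DeepNet.net θstar (DeepNet.castE hin.symm x))) := by
  refine ⟨80, 324 * K₁ * (K₂ + 1) + 1, 1, 1, by norm_num, by positivity, ?_⟩
  intro d m h hstar hin hout l β ε p X Y θA θB θstar hd hm hconv hl hwidth hp hp₁ hA hB hcol
  simp only [pow_one] at hwidth hA hB ⊢
  have hW : 0 < 80 * Real.log (d + 1) :=
    mul_pos (by norm_num) (Real.log_pos (by norm_cast; omega))
  obtain ⟨θA', DA, hsegA, hcardA, hdeadA⟩ := DeepNet.exists_deadOn (Y := Y) hK₁ hK₂.le hd hm hl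
    hwidth hp hp₁ hW hA fun k hk c => (hcol k hk c).1
  obtain ⟨θB', DB, hsegB, hcardB, hdeadB⟩ := DeepNet.exists_deadOn (Y := Y) hK₁ hK₂.le hd hm hl
    hwidth hp hp₁ hW hB fun k hk c => (hcol k hk c).2
  exact DeepNet.exists_path_of_deadOn hin hout hconv (by omega) hcardA hcardB hdeadA hdeadB
    (hsegA.trans (DeepNet.lossSublevel_mono ((le_max_left _ _).trans (le_max_left _ _))))
    (hsegB.trans (DeepNet.lossSublevel_mono ((le_max_right _ _).trans (le_max_left _ _))))
    (le_max_right _ _)
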